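/- Let $M$ be a compact Riemannian surface, i.e. a compact 2-dimensional manifold without boundary (of class $C^\infty$, or just $C^2$) with a smooth (or just continuous) Riemannian metric $\|\cdot\|$ and induced distance $d$ ($d=\infty$ between different components). Let $f:M\to M$ be a $C^{1+\alpha}$ diffeomorphism for some $0<\alpha\le 1$, meaning that $f$ is a $C^1$ diffeomorphism whose differential is locally $\alpha$-Hölder in charts. For $x\in M$ and $v\in T_xM\setminus\{0\}$ put, with $\log 0=-\infty$, $$\chi(x)=\limsup_{n\to+\infty}\frac1n\log\|d_xf^n\|,\qquad \chi(x,v)=\limsup_{n\to+\infty}\frac1n\log\|d_xf^n(v)\|,$$ $$W^s(x)=\Big\{y\in M:\ \limsup_{n\to+\infty}\frac1n\log d(f^nx,f^ny)<0\Big\}.$$ The function $\chi(x,\cdot)$ takes finitely many values $\chi_1(x)>\dots>\chi_{p(x)}(x)$ on $T_xM\setminus\{0\}$, with $p(x)\le 2$; if $p(x)=1$ put $\chi_2(x)=\chi_1(x)$. The point $x$ is called Lyapunov regular if there is a decomposition $T_xM=\bigoplus_{i=1}^{p(x)}H_i(x)$ into linear subspaces such that, for all $i$ and all $v\in H_i(x)\setminus\{0\}$,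 $$\lim_{n\to\pm\infty}\frac1n\log\|d_xf^n(v)\|=\chi_i(x),$$ with uniform convergence on $\{v\in H_i(x):\|v\|=1\}$, and $$\lim_{n\to\pm\infty}\frac1n\log\operatorname{Jac}(d_xf^n)=\sum_{i}\dim(H_i(x))\,\chi_i(x),$$ where $\operatorname{Jac}$ is the absolute value of the determinant in orthonormal bases. If $x\in M$ is Lyapunov regular with $\chi_1(x)>0>\chi_2(x)$ and $y\in W^s(x)$, then $\chi(y)=\chi(x)$. -/

import Mathlib

open Set Filter Topology Bundle
open scoped Manifold ContDiff ENNReal NNReal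

noncomputable section

/-- The Jacobian `Jac A` of a linear map between Euclidean spaces: the square root of the Gram
determinant of the image of an orthonormal basis of the source (that is, `√det (Aᵀ A)`; for spaces
of the same dimension this is `|det A|` computed in orthonormal bases). -/
def linJac {V W : Type*} [NormedAddCommGroup V] [InnerProductSpace ℝ V] [FiniteDimensional ℝ V]
    [NormedAddCommGroup W] [InnerProductSpace ℝ W] (A : V →L[ℝ] W) : ℝ :=
  Real.sqrt (Matrix.det (Matrix.of fun i j : Fin (Module.finrank ℝ V) =>
    inner ℝ (A (stdOrthonormalBasis ℝ V i)) (A (stdOrthonormalBasis ℝ V j))))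

namespace SurfaceDiffeo

section Smooth

variable {M : Type*} [TopologicalSpace M] [ChartedSpace (EuclideanSpace ℝ (Fin 2)) M]

instance finiteDimensional_tangentSpace (x : M) :
    FiniteDimensional ℝ (TangentSpace (𝓡 2) x) :=
  inferInstanceAs (FiniteDimensional ℝ (EuclideanSpace ℝ (Fin 2)))

/-- The iterate `f^n`, `n ∈ ℤ`, of a `C^1` diffeomorphism. -/
def iter (f : Diffeomorph (𝓡 2) (𝓡 2) M M 1) (n : ℤ) : M → M :=
  ⇑((f.toEquiv : Equiv.Perm M) ^ n)

/-- The differential `d_x f^n : T_x M → T_{f^n x} M`, `n ∈ ℤ`. -/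
def D (f : Diffeomorph (𝓡 2) (𝓡 2) M M 1) (n : ℤ) (x : M) :
    TangentSpace (𝓡 2) x →L[ℝ] TangentSpace (𝓡 2) (iter f n x) :=
  mfderiv (𝓡 2) (𝓡 2) (iter f n) x

/-- `f` is of class `C^{1+α}`: in local charts its differential is locally `α`-Hölder. -/
def IsC1Holder (f : Diffeomorph (𝓡 2) (𝓡 2) M M 1) (α : ℝ≥0) : Prop :=
  ∀ x : M, ∃ C : ℝ≥0, ∃ U ∈ 𝓝 (extChartAt (𝓡 2) x x),
    HolderOnWith C α (fderiv ℝ (writtenInExtChartAt (𝓡 2) (𝓡 2) x f)) U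

end Smooth

section Riemannian

variable {M : Type*} [EMetricSpace M] [ChartedSpace (EuclideanSpace ℝ (Fin 2)) M]
  [RiemannianBundle (fun x : M => TangentSpace (𝓡 2) x)]

/-- The maximal Lyapunov exponent `χ(x) = limsup_n (1/n) log ‖d_x f^n‖`. -/
def chi (f : Diffeomorph (𝓡 2) (𝓡 2) M M 1) (x : M) : EReal :=
  limsup (fun n : ℕ => ENNReal.log ‖D f n x‖ₑ / (n : EReal)) atTop

/-- The Lyapunov exponent `χ(x, v) = limsup_n (1/n) log ‖d_x f^n v‖` of a tangent vector. -/
def chiVec (f : Diffeomorph (𝓡 2) (𝓡 2) M M 1) (x : M) (v : TangentSpace (𝓡 2) x) : EReal :=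
  limsup (fun n : ℕ => ENNReal.log ‖D f n x v‖ₑ / (n : EReal)) atTop

/-- The set `{χ_1(x) > ... > χ_{p(x)}(x)}` of values of `χ(x, ·)` on nonzero tangent vectors. -/
def exponents (f : Diffeomorph (𝓡 2) (𝓡 2) M M 1) (x : M) : Set EReal :=
  {c | ∃ v : TangentSpace (𝓡 2) x, v ≠ 0 ∧ chiVec f x v = c}

/-- The largest exponent `χ_1(x)`. -/
def chi₁ (f : Diffeomorph (𝓡 2) (𝓡 2) M M 1) (x : M) : EReal := sSup (exponents f x)

/-- The exponent `χ_2(x)`: the second value of `χ(x, ·)` if there are two, and `χ_1(x)` if there is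
only one. On a surface there are at most two values, so this is the least one. -/
def chi₂ (f : Diffeomorph (𝓡 2) (𝓡 2) M M 1) (x : M) : EReal := sInf (exponents f x)

/-- Lyapunov regularity of `x`: there is a splitting `T_x M = ⨁ H_i`, indexed by the exponents
`χ_1(x) > ... > χ_p(x)`, such that `(1/n) log ‖d_x f^n v‖ → χ_i(x)` as `n → ±∞` for all nonzero
`v ∈ H_i`, uniformly on the unit sphere of `H_i`, and
`(1/n) log Jac (d_x f^n) → ∑ i, dim H_i * χ_i(x)` as `n → ±∞`. -/
def IsRegular (f : Diffeomorph (𝓡 2) (𝓡 2) M M 1) (x : M) : Prop :=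
  ∃ (p : ℕ) (lam : Fin p → ℝ) (H : Fin p → Submodule ℝ (TangentSpace (𝓡 2) x)),
    StrictAnti lam ∧
    Set.range (fun i => (lam i : EReal)) = exponents f x ∧
    DirectSum.IsInternal H ∧
    (∀ i, ∀ l ∈ ({atTop, atBot} : Set (Filter ℤ)),
      (∀ v ∈ H i, v ≠ 0 →
        Tendsto (fun n : ℤ => (1 / (n : ℝ)) * Real.log ‖D f n x v‖) l (𝓝 (lam i))) ∧
      TendstoUniformlyOn
        (fun (n : ℤ) (v : TangentSpace (𝓡 2) x) => (1 / (n : ℝ)) * Real.log ‖D f n x v‖)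
        (fun _ => lam i) l {v | v ∈ H i ∧ ‖v‖ = 1}) ∧
    (∀ l ∈ ({atTop, atBot} : Set (Filter ℤ)),
      Tendsto (fun n : ℤ => (1 / (n : ℝ)) * Real.log (linJac (D f n x))) l
        (𝓝 (∑ i, (Module.finrank ℝ (H i) : ℝ) * lam i)))

/-- The set `𝓡^{+*}` of regular points with `χ_1(x) > 0 > χ_2(x)`. -/
def regularSaddle (f : Diffeomorph (𝓡 2) (𝓡 2) M M 1) : Set M :=
  {x | IsRegular f x ∧ 0 < chi₁ f x ∧ chi₂ f x < 0}

/-- The stable set `W^s(x) = {y | limsup_n (1/n) log d(f^n x, f^n y) < 0}` (with `log 0 = -∞`). -/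
def stableSet (f : Diffeomorph (𝓡 2) (𝓡 2) M M 1) (x : M) : Set M :=
  {y | limsup (fun n : ℕ =>
    ENNReal.log (edist (iter f n x) (iter f n y)) / (n : EReal)) atTop < 0}

end Riemannian

end SurfaceDiffeo

end

noncomputable section

namespace SurfaceDiffeo

/-- The Euclidean plane. -/
abbrev Plane : Type := EuclideanSpace ℝ (Fin 2)

/-- The determinant of two vectors of the Euclidean plane. -/
def wedge (v w : Plane) : ℝ := v 0 * w 1 - v 1 * w 0

lemma wedge_sq_add_inner_sq (v w : Plane) :
    wedge v w ^ 2 + inner ℝ v w ^ 2 = ‖v‖ ^ 2 * ‖w‖ ^ 2 := by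
  rw [EuclideanSpace.norm_sq_eq, EuclideanSpace.norm_sq_eq, PiLp.inner_apply]
  simp only [Fin.sum_univ_two, Real.norm_eq_abs, sq_abs, wedge, RCLike.inner_apply, conj_trivial]
  ring

lemma abs_wedge_le (v w : Plane) : |wedge v w| ≤ ‖v‖ * ‖w‖ := by
  apply abs_le_of_sq_le_sq _ (by positivity)
  have := wedge_sq_add_inner_sq v w
  nlinarith [sq_nonneg (inner ℝ v w : ℝ)]

lemma wedge_add_smul_left (s t : ℝ) (v v' w : Plane) :
    wedge (s • v + t • v') w = s * wedge v w + t * wedge v' w := by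
  simp [wedge]; ring

lemma wedge_add_smul_right (s t : ℝ) (v v' w : Plane) :
    wedge w (s • v + t • v') = s * wedge w v + t * wedge w v' := by
  simp [wedge]; ring

lemma wedge_self (v : Plane) : wedge v v = 0 := by
  simp [wedge]; ring

/-- First coordinate of `v` in the basis `(a, b)`. -/
def fstCoord (a b v : Plane) : ℝ := wedge v b / wedge a b

/-- Second coordinate of `v` in the basis `(a, b)`. -/
def sndCoord (a b v : Plane) : ℝ := wedge a v / wedge a b

lemma fstCoord_smul_add_sndCoord_smul {a b : Plane} (h : wedge a b ≠ 0) (v : Plane) :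
    fstCoord a b v • a + sndCoord a b v • b = v := by
  ext i
  simp only [fstCoord, sndCoord, PiLp.add_apply, PiLp.smul_apply, smul_eq_mul]
  field_simp
  fin_cases i <;> simp [wedge] <;> ring

lemma fstCoord_comb {a b : Plane} (h : wedge a b ≠ 0) (s t : ℝ) :
    fstCoord a b (s • a + t • b) = s := by
  rw [fstCoord, wedge_add_smul_left, wedge_self]; field_simp; ring

lemma sndCoord_comb {a b : Plane} (h : wedge a b ≠ 0) (s t : ℝ) :
    sndCoord a b (s • a + t • b) = t := by
  rw [sndCoord, wedge_add_smul_right, wedge_self]; field_simp; ring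

lemma fstCoord_sub (a b v w : Plane) :
    fstCoord a b (v - w) = fstCoord a b v - fstCoord a b w := by
  simp only [fstCoord, wedge, PiLp.sub_apply]; ring

lemma sndCoord_sub (a b v w : Plane) :
    sndCoord a b (v - w) = sndCoord a b v - sndCoord a b w := by
  simp only [sndCoord, wedge, PiLp.sub_apply]; ring

/-- A summable multiplicative perturbation keeps a nonnegative sequence bounded. -/
lemma growth_le_of_geometric {c r : ℝ} (hc : 0 ≤ c) (hr0 : 0 ≤ r) (hr1 : r < 1) {s : ℕ → ℝ}
    (hs : ∀ n, 0 ≤ s n) {N : ℕ} (h : ∀ n ≥ N, s (n + 1) ≤ (1 + c * r ^ n) * s n) :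
    ∀ n ≥ N, s n ≤ s N * Real.exp (c * r ^ N / (1 - r)) := by
  have hr : 0 < 1 - r := by linarith
  have key : ∀ n ≥ N, s n * Real.exp (c * r ^ n / (1 - r)) ≤
      s N * Real.exp (c * r ^ N / (1 - r)) := by
    intro n hn
    induction n, hn using Nat.le_induction with
    | base => exact le_rfl
    | succ n hn ih =>
      refine le_trans ?_ ih
      have e : c * r ^ n / (1 - r) = c * r ^ n + c * r ^ (n + 1) / (1 - r) := by
        field_simp; ring
      rw [e, Real.exp_add, ← mul_assoc]
      gcongr
      refine (h n hn).trans ?_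
      rw [mul_comm]
      gcongr
      · exact hs n
      · linarith [Real.add_one_le_exp (c * r ^ n)]
  intro n hn
  refine le_trans ?_ (key n hn)
  refine le_mul_of_one_le_right (hs n) (Real.one_le_exp (by positivity))

lemma abs_sub_le_of_geometric {c r B : ℝ} (hc : 0 ≤ c) (hr0 : 0 ≤ r) (hr1 : r < 1)
    (hB : 0 ≤ B) {u : ℕ → ℝ} {N : ℕ} (h : ∀ n ≥ N, |u (n + 1) - u n| ≤ c * r ^ n * B) :
    ∀ n ≥ N, |u n - u N| ≤ c * r ^ N / (1 - r) * B := by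
  have hr : 0 < 1 - r := by linarith
  have key : ∀ n ≥ N, |u n - u N| ≤ (c * r ^ N / (1 - r) - c * r ^ n / (1 - r)) * B := by
    intro n hn
    induction n, hn using Nat.le_induction with
    | base => simp
    | succ n hn ih =>
      have e : c * r ^ n / (1 - r) = c * r ^ n + c * r ^ (n + 1) / (1 - r) := by
        field_simp; ring
      calc |u (n + 1) - u N| ≤ |u (n + 1) - u n| + |u n - u N| := abs_sub_le _ _ _
        _ ≤ c * r ^ n * B + (c * r ^ N / (1 - r) - c * r ^ n / (1 - r)) * B :=
            add_le_add (h n hn) ih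
        _ = _ := by rw [e]; ring
  intro n hn
  refine (key n hn).trans ?_
  gcongr
  have : 0 ≤ c * r ^ n / (1 - r) := by positivity
  linarith

/-- Hypotheses on the reference sequence of linear maps of the plane: `a` and `b` are orbits growing
at most at the rates `l₁ ≥ l₂` and spanning an area of rate at least `l₁ + l₂`, and `B` is an
exponentially small perturbation of `A`. -/
structure PerturbedRegular (A B : ℕ → Plane →L[ℝ] Plane) (a b : ℕ → Plane) (l₁ l₂ : ℝ) :
    Prop where
  le : l₂ ≤ l₁
  orbit_fst : ∀ n, a (n + 1) = A n (a n)
  orbit_snd : ∀ n, b (n + 1) = A n (b n)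
  close : ∃ C ≥ 0, ∃ γ > 0, ∀ᶠ n : ℕ in atTop, ‖B n - A n‖ ≤ C * Real.exp (-γ * n)
  fst_le : ∀ ε > 0, ∀ᶠ n : ℕ in atTop, ‖a n‖ ≤ Real.exp ((l₁ + ε) * n)
  snd_le : ∀ ε > 0, ∀ᶠ n : ℕ in atTop, ‖b n‖ ≤ Real.exp ((l₂ + ε) * n)
  le_wedge : ∀ ε > 0, ∀ᶠ n : ℕ in atTop, Real.exp ((l₁ + l₂ - ε) * n) ≤ |wedge (a n) (b n)|

namespace PerturbedRegular

variable {A B : ℕ → Plane →L[ℝ] Plane} {a b : ℕ → Plane} {l₁ l₂ : ℝ}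

/-- Size of a vector in the coordinates given by the moving basis `(a n, b n)`. -/
def size (a b : ℕ → Plane) (l₁ l₂ : ℝ) (n : ℕ) (v : Plane) : ℝ :=
  |fstCoord (a n) (b n) v| + Real.exp (-(l₁ - l₂) * n) * |sndCoord (a n) (b n) v|

lemma size_nonneg (n : ℕ) (v : Plane) : 0 ≤ size a b l₁ l₂ n v := by
  unfold size; positivity

/-- The coordinates in the moving basis are almost preserved by the perturbed maps. -/
lemma exists_coord_estimate (H : PerturbedRegular A B a b l₁ l₂) :
    ∃ K ≥ 0, ∃ r ≥ 0, r < 1 ∧ ∀ᶠ n : ℕ in atTop, ∀ v,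
      |fstCoord (a (n + 1)) (b (n + 1)) (B n v) - fstCoord (a n) (b n) v|
        ≤ K * r ^ n * size a b l₁ l₂ n v ∧
      Real.exp (-(l₁ - l₂) * (n + 1 : ℕ)) *
        |sndCoord (a (n + 1)) (b (n + 1)) (B n v) - sndCoord (a n) (b n) v|
        ≤ K * r ^ n * size a b l₁ l₂ n v := by
  obtain ⟨C, hC, γ, hγ, hclose⟩ := H.close
  set ε := γ / 6 with hε
  have hε0 : 0 < ε := by positivity
  refine ⟨C * Real.exp (-l₁ + 2 * ε), by positivity, Real.exp (-γ + 3 * ε), by positivity,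
    by rw [Real.exp_lt_one_iff]; linarith, ?_⟩
  have h1 := H.fst_le ε hε0
  have h2 := H.snd_le ε hε0
  have h3 := H.le_wedge ε hε0
  filter_upwards [hclose, h1, h2, h3, (tendsto_add_atTop_nat 1).eventually h1,
    (tendsto_add_atTop_nat 1).eventually h2, (tendsto_add_atTop_nat 1).eventually h3]
    with n hcl ha hb hw ha' hb' hw' v
  have hne : wedge (a n) (b n) ≠ 0 := by
    intro h; rw [h, abs_zero] at hw; exact absurd hw (not_le.2 (Real.exp_pos _))
  have hpos' : 0 < |wedge (a (n + 1)) (b (n + 1))| := (Real.exp_pos _).trans_le hw'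
  have hne' : wedge (a (n + 1)) (b (n + 1)) ≠ 0 := abs_pos.1 hpos'
  have hv := fstCoord_smul_add_sndCoord_smul hne v
  have hAv : A n v = fstCoord (a n) (b n) v • a (n + 1) + sndCoord (a n) (b n) v • b (n + 1) := by
    conv_lhs => rw [← hv]
    rw [map_add, map_smul, map_smul, H.orbit_fst, H.orbit_snd]
  have hvnorm : ‖v‖ ≤ Real.exp ((l₁ + ε) * n) * size a b l₁ l₂ n v := by
    conv_lhs => rw [← hv]
    refine (norm_add_le _ _).trans ?_
    rw [norm_smul, norm_smul, Real.norm_eq_abs, Real.norm_eq_abs, size, mul_add,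
      ← mul_assoc, ← Real.exp_add, mul_comm |fstCoord _ _ _|, mul_comm |sndCoord _ _ _|]
    have e : (l₁ + ε) * n + -(l₁ - l₂) * n = (l₂ + ε) * n := by ring
    rw [e]
    gcongr
  set e := (B n - A n) v with he
  have henorm : ‖e‖ ≤ C * Real.exp (-γ * n) * (Real.exp ((l₁ + ε) * n) * size a b l₁ l₂ n v) :=
    (ContinuousLinearMap.le_opNorm _ _).trans (by gcongr)
  have hBv : B n v - A n v = e := by simp [he]
  have hfst : fstCoord (a (n + 1)) (b (n + 1)) (B n v) - fstCoord (a n) (b n) v =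
      fstCoord (a (n + 1)) (b (n + 1)) e := by
    rw [← hBv, fstCoord_sub, hAv, fstCoord_comb hne']
  have hsnd : sndCoord (a (n + 1)) (b (n + 1)) (B n v) - sndCoord (a n) (b n) v =
      sndCoord (a (n + 1)) (b (n + 1)) e := by
    rw [← hBv, sndCoord_sub, hAv, sndCoord_comb hne']
  have hfin : ‖e‖ * Real.exp ((-l₁ + 2 * ε) * (n + 1 : ℕ)) ≤
      C * Real.exp (-l₁ + 2 * ε) * Real.exp (-γ + 3 * ε) ^ n * size a b l₁ l₂ n v := by
    refine (mul_le_mul_of_nonneg_right henorm (Real.exp_pos _).le).trans (le_of_eq ?_)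
    rw [← Real.exp_nat_mul]
    have : Real.exp (-γ * n) * Real.exp ((l₁ + ε) * n) *
        Real.exp ((-l₁ + 2 * ε) * (n + 1 : ℕ)) =
        Real.exp (-l₁ + 2 * ε) * Real.exp (n * (-γ + 3 * ε)) := by
      rw [← Real.exp_add, ← Real.exp_add, ← Real.exp_add]; congr 1; push_cast; ring
    linear_combination (C * size a b l₁ l₂ n v) * this
  rw [hfst, hsnd]
  refine ⟨le_trans ?_ hfin, le_trans ?_ hfin⟩
  · rw [fstCoord, abs_div, div_le_iff₀ hpos']
    calc |wedge e (b (n + 1))| ≤ ‖e‖ * Real.exp ((l₂ + ε) * (n + 1 : ℕ)) :=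
          (abs_wedge_le _ _).trans (by gcongr)
      _ = ‖e‖ * Real.exp ((-l₁ + 2 * ε) * (n + 1 : ℕ)) *
          Real.exp ((l₁ + l₂ - ε) * (n + 1 : ℕ)) := by
        rw [mul_assoc, ← Real.exp_add]; congr 2; ring
      _ ≤ _ := by gcongr
  · rw [sndCoord, abs_div, ← mul_div_assoc, div_le_iff₀ hpos']
    calc Real.exp (-(l₁ - l₂) * (n + 1 : ℕ)) * |wedge (a (n + 1)) e|
        ≤ Real.exp (-(l₁ - l₂) * (n + 1 : ℕ)) * (Real.exp ((l₁ + ε) * (n + 1 : ℕ)) * ‖e‖) := by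
          gcongr; exact (abs_wedge_le _ _).trans (by gcongr)
      _ = ‖e‖ * (Real.exp ((-l₁ + 2 * ε) * (n + 1 : ℕ)) *
          Real.exp ((l₁ + l₂ - ε) * (n + 1 : ℕ))) := by
        rw [← mul_assoc, ← Real.exp_add, ← Real.exp_add, mul_comm]; congr 2; ring
      _ ≤ _ := by rw [← mul_assoc]; gcongr

lemma exists_size_estimate (H : PerturbedRegular A B a b l₁ l₂) :
    ∃ K ≥ 0, ∃ r ≥ 0, r < 1 ∧ ∀ᶠ n : ℕ in atTop, ∀ v,
      |fstCoord (a (n + 1)) (b (n + 1)) (B n v) - fstCoord (a n) (b n) v|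
        ≤ K * r ^ n * size a b l₁ l₂ n v ∧
      size a b l₁ l₂ (n + 1) (B n v) ≤ (1 + K * r ^ n) * size a b l₁ l₂ n v := by
  obtain ⟨K, hK, r, hr0, hr1, h⟩ := H.exists_coord_estimate
  refine ⟨2 * K, by positivity, r, hr0, hr1, ?_⟩
  filter_upwards [h] with n hn v
  obtain ⟨h1, h2⟩ := hn v
  have hpos : 0 ≤ K * r ^ n * size a b l₁ l₂ n v :=
    mul_nonneg (by positivity) (size_nonneg n v)
  refine ⟨by linarith, ?_⟩
  have hexp : Real.exp (-(l₁ - l₂) * (n + 1 : ℕ)) ≤ Real.exp (-(l₁ - l₂) * n) := by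
    apply Real.exp_le_exp.2
    push_cast
    nlinarith [H.le]
  have h3 : |fstCoord (a (n + 1)) (b (n + 1)) (B n v)| ≤ |fstCoord (a n) (b n) v| +
      |fstCoord (a (n + 1)) (b (n + 1)) (B n v) - fstCoord (a n) (b n) v| := by
    simpa using abs_add_le (fstCoord (a n) (b n) v)
      (fstCoord (a (n + 1)) (b (n + 1)) (B n v) - fstCoord (a n) (b n) v)
  have h4 : |sndCoord (a (n + 1)) (b (n + 1)) (B n v)| ≤ |sndCoord (a n) (b n) v| +
      |sndCoord (a (n + 1)) (b (n + 1)) (B n v) - sndCoord (a n) (b n) v| := by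
    simpa using abs_add_le (sndCoord (a n) (b n) v)
      (sndCoord (a (n + 1)) (b (n + 1)) (B n v) - sndCoord (a n) (b n) v)
  have h5 := mul_le_mul_of_nonneg_left h4 (Real.exp_pos (-(l₁ - l₂) * (n + 1 : ℕ))).le
  have h6 := mul_le_mul_of_nonneg_right hexp (abs_nonneg (sndCoord (a n) (b n) v))
  have e : (1 + 2 * K * r ^ n) * size a b l₁ l₂ n v =
      size a b l₁ l₂ n v + K * r ^ n * size a b l₁ l₂ n v + K * r ^ n * size a b l₁ l₂ n v := by
    ring
  rw [e]
  conv_rhs => rw [size]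
  rw [size] at h1 h2 ⊢
  linarith

lemma wedge_ne_zero (H : PerturbedRegular A B a b l₁ l₂) :
    ∀ᶠ n : ℕ in atTop, wedge (a n) (b n) ≠ 0 := by
  filter_upwards [H.le_wedge 1 one_pos] with n hn
  exact abs_pos.1 ((Real.exp_pos _).trans_le hn)

/-- Orbits of the perturbed maps grow at most at the rate `l₁`. -/
theorem norm_le (H : PerturbedRegular A B a b l₁ l₂) {V : ℕ → Plane} {N : ℕ}
    (hV : ∀ n ≥ N, V (n + 1) = B n (V n)) {ε : ℝ} (hε : 0 < ε) :
    ∀ᶠ n : ℕ in atTop, ‖V n‖ ≤ Real.exp ((l₁ + ε) * n) := by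
  obtain ⟨K, hK, r, hr0, hr1, h⟩ := H.exists_size_estimate
  obtain ⟨N₁, hN₁⟩ := eventually_atTop.1 h
  set m := max N N₁ with hm
  have hgrow := growth_le_of_geometric hK hr0 hr1 (s := fun n => size a b l₁ l₂ n (V n))
    (fun n => size_nonneg n _) (N := m) (fun n hn => by
      have hn1 : N ≤ n := (le_max_left _ _).trans hn
      have hn2 : N₁ ≤ n := (le_max_right _ _).trans hn
      simpa [hV n hn1] using (hN₁ n hn2 (V n)).2)
  set Q := size a b l₁ l₂ m (V m) * Real.exp (K * r ^ m / (1 - r)) with hQ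
  have hlim : ∀ᶠ n : ℕ in atTop, Q ≤ Real.exp (ε / 2 * n) := by
    have : Tendsto (fun n : ℕ => Real.exp (ε / 2 * n)) atTop atTop :=
      Real.tendsto_exp_atTop.comp
        (tendsto_natCast_atTop_atTop.const_mul_atTop (by positivity))
    exact this.eventually_ge_atTop Q
  filter_upwards [H.wedge_ne_zero, H.fst_le (ε / 2) (by positivity),
    H.snd_le (ε / 2) (by positivity), hlim, eventually_ge_atTop m] with n hne ha hb hq hnm
  have hv := fstCoord_smul_add_sndCoord_smul hne (V n)
  have hvnorm : ‖V n‖ ≤ Real.exp ((l₁ + ε / 2) * n) * size a b l₁ l₂ n (V n) := by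
    conv_lhs => rw [← hv]
    refine (norm_add_le _ _).trans ?_
    rw [norm_smul, norm_smul, Real.norm_eq_abs, Real.norm_eq_abs, size, mul_add,
      ← mul_assoc, ← Real.exp_add, mul_comm |fstCoord _ _ _|, mul_comm |sndCoord _ _ _|]
    have e : (l₁ + ε / 2) * n + -(l₁ - l₂) * n = (l₂ + ε / 2) * n := by ring
    rw [e]
    gcongr
  calc ‖V n‖ ≤ Real.exp ((l₁ + ε / 2) * n) * Real.exp (ε / 2 * n) :=
        hvnorm.trans (by gcongr; exact (hgrow n hnm).trans hq)
    _ = _ := by rw [← Real.exp_add]; congr 1; ring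

/-- Orbits of the perturbed maps started on `a` at a late time grow at least at the rate `l₁`. -/
theorem exists_le_norm (H : PerturbedRegular A B a b l₁ l₂) (N₀ : ℕ) :
    ∃ N ≥ N₀, ∀ V : ℕ → Plane, V N = a N → (∀ n ≥ N, V (n + 1) = B n (V n)) →
      ∀ ε > 0, ∀ᶠ n : ℕ in atTop, Real.exp ((l₁ - ε) * n) ≤ ‖V n‖ := by
  obtain ⟨K, hK, r, hr0, hr1, h⟩ := H.exists_size_estimate
  have hg : Tendsto (fun n : ℕ => K * r ^ n / (1 - r)) atTop (𝓝 0) := by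
    have := ((tendsto_pow_atTop_nhds_zero_of_lt_one hr0 hr1).const_mul K).div_const (1 - r)
    simpa using this
  have hg' : Tendsto (fun n : ℕ => K * r ^ n / (1 - r) * Real.exp (K * r ^ n / (1 - r)))
      atTop (𝓝 0) := by
    have := hg.mul (Real.continuous_exp.tendsto 0 |>.comp hg)
    simpa using this
  obtain ⟨N, hNle, hNsmall, hN, hNne⟩ : ∃ N, N₀ ≤ N ∧
      K * r ^ N / (1 - r) * Real.exp (K * r ^ N / (1 - r)) ≤ 1 / 2 ∧
      (∀ n ≥ N, ∀ v,
      |fstCoord (a (n + 1)) (b (n + 1)) (B n v) - fstCoord (a n) (b n) v|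
        ≤ K * r ^ n * size a b l₁ l₂ n v ∧
      size a b l₁ l₂ (n + 1) (B n v) ≤ (1 + K * r ^ n) * size a b l₁ l₂ n v) ∧
      wedge (a N) (b N) ≠ 0 := by
    obtain ⟨N₁, hN₁⟩ := eventually_atTop.1 h
    obtain ⟨N, hN⟩ := ((eventually_ge_atTop N₀).and ((hg'.eventually_le_const
      (by norm_num : (0 : ℝ) < 1 / 2)).and ((eventually_ge_atTop N₁).and H.wedge_ne_zero))).exists
    exact ⟨N, hN.1, hN.2.1, fun n hn => hN₁ n (hN.2.2.1.trans hn), hN.2.2.2⟩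
  refine ⟨N, hNle, fun V hVN hV ε hε => ?_⟩
  have hfst : fstCoord (a N) (b N) (V N) = 1 := by
    rw [hVN]; simpa using fstCoord_comb hNne 1 0
  have hsnd : sndCoord (a N) (b N) (V N) = 0 := by
    rw [hVN]; simpa using sndCoord_comb hNne 1 0
  have hgrow := growth_le_of_geometric hK hr0 hr1 (s := fun n => size a b l₁ l₂ n (V n))
    (fun n => size_nonneg n _) (N := N) (fun n hn => by
      simpa [hV n hn] using (hN n hn (V n)).2)
  have hsN : size a b l₁ l₂ N (V N) = 1 := by simp [size, hfst, hsnd]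
  simp only [hsN, one_mul] at hgrow
  have hu := abs_sub_le_of_geometric hK hr0 hr1 (Real.exp_pos (K * r ^ N / (1 - r))).le
    (u := fun n => fstCoord (a n) (b n) (V n)) (N := N) (fun n hn => by
      have := (hN n hn (V n)).1
      rw [← hV n hn] at this
      exact this.trans (by gcongr; exact hgrow n hn))
  have hlow : ∀ n ≥ N, 1 / 2 ≤ |fstCoord (a n) (b n) (V n)| := by
    intro n hn
    have h1 := (hu n hn).trans hNsmall
    simp only [hfst] at h1
    have := neg_le_of_abs_le h1
    exact le_trans (by linarith) (le_abs_self _)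
  have hlim : ∀ᶠ n : ℕ in atTop, 2 ≤ Real.exp (ε / 2 * n) := by
    have : Tendsto (fun n : ℕ => Real.exp (ε / 2 * n)) atTop atTop :=
      Real.tendsto_exp_atTop.comp
        (tendsto_natCast_atTop_atTop.const_mul_atTop (by positivity))
    exact this.eventually_ge_atTop 2
  filter_upwards [H.le_wedge (ε / 4) (by positivity), H.snd_le (ε / 4) (by positivity), hlim,
    eventually_ge_atTop N] with n hw hb hq hn
  have hpos : 0 < |wedge (a n) (b n)| := (Real.exp_pos _).trans_le hw
  have h1 := hlow n hn
  rw [fstCoord, abs_div, le_div_iff₀ hpos] at h1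
  have h2 : 1 / 2 * Real.exp ((l₁ + l₂ - ε / 4) * n) ≤ ‖V n‖ * Real.exp ((l₂ + ε / 4) * n) :=
    calc _ ≤ 1 / 2 * |wedge (a n) (b n)| := by gcongr
      _ ≤ |wedge (V n) (b n)| := h1
      _ ≤ ‖V n‖ * ‖b n‖ := abs_wedge_le _ _
      _ ≤ _ := by gcongr
  have h3 : Real.exp ((l₁ - ε) * n) * Real.exp (ε / 2 * n) * Real.exp ((l₂ + ε / 4) * n) =
      Real.exp ((l₁ + l₂ - ε / 4) * n) := by
    rw [← Real.exp_add, ← Real.exp_add]; congr 1; ring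
  have h4 : Real.exp ((l₁ - ε) * n) * 2 * Real.exp ((l₂ + ε / 4) * n) ≤
      Real.exp ((l₁ + l₂ - ε / 4) * n) := by
    rw [← h3]; gcongr
  refine le_of_mul_le_mul_right ?_ (Real.exp_pos ((l₂ + ε / 4) * n))
  linarith

end PerturbedRegular

/-- `g` is `α`-Hölder on a neighbourhood of `x`. -/
def LocHolderAt {X Y : Type*} [PseudoEMetricSpace X] [PseudoEMetricSpace Y] (α : ℝ≥0)
    (g : X → Y) (x : X) : Prop :=
  ∃ C : ℝ≥0, ∃ U ∈ 𝓝 x, HolderOnWith C α g U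

namespace LocHolderAt

section

variable {X Y Z : Type*} [PseudoEMetricSpace X] [PseudoEMetricSpace Y] [PseudoEMetricSpace Z]
  {α β : ℝ≥0}

lemma comp {g : Y → Z} {h : X → Y} {x : X} (hg : LocHolderAt α g (h x))
    (hh : LocHolderAt β h x) (hc : ContinuousAt h x) : LocHolderAt (α * β) (g ∘ h) x := by
  obtain ⟨C, U, hU, hgU⟩ := hg
  obtain ⟨D, V, hV, hhV⟩ := hh
  refine ⟨_, V ∩ h ⁻¹' U, inter_mem hV (hc hU), hgU.comp (hhV.mono inter_subset_left) ?_⟩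
  exact fun y hy => hy.2

lemma prodMk {g : X → Y} {h : X → Z} {x : X} (hg : LocHolderAt α g x)
    (hh : LocHolderAt α h x) : LocHolderAt α (fun y => (g y, h y)) x := by
  obtain ⟨C, U, hU, hgU⟩ := hg
  obtain ⟨D, V, hV, hhV⟩ := hh
  refine ⟨max C D, U ∩ V, inter_mem hU hV, fun y hy y' hy' => ?_⟩
  rw [Prod.edist_eq]
  refine max_le ((hgU y hy.1 y' hy'.1).trans ?_) ((hhV y hy.2 y' hy'.2).trans ?_)
  · gcongr; exact le_max_left _ _
  · gcongr; exact le_max_right _ _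

lemma congr {g h : X → Y} {x : X} (hg : LocHolderAt α g x) (e : g =ᶠ[𝓝 x] h) :
    LocHolderAt α h x := by
  obtain ⟨C, U, hU, hgU⟩ := hg
  refine ⟨C, U ∩ {y | g y = h y}, inter_mem hU e, fun y hy y' hy' => ?_⟩
  have e1 : g y = h y := hy.2
  have e2 : g y' = h y' := hy'.2
  rw [← e1, ← e2]
  exact hgU y hy.1 y' hy'.1

lemma mono {g : X → Y} {x : X} (hg : LocHolderAt β g x) (h : α ≤ β) : LocHolderAt α g x := by
  obtain ⟨C, U, hU, hgU⟩ := hg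
  refine ⟨_, U ∩ Metric.eball x 1,
    inter_mem hU (Metric.eball_mem_nhds x one_pos),
    (hgU.mono inter_subset_left).of_le (D := 2) (fun y hy y' hy' => ?_) h⟩
  calc edist y y' ≤ edist y x + edist y' x := edist_triangle_right _ _ _
    _ ≤ 1 + 1 := add_le_add (le_of_lt hy.2) (le_of_lt hy'.2)
    _ = (2 : ℝ≥0) := by norm_num

end

section

variable {E F G : Type*} [NormedAddCommGroup E] [NormedSpace ℝ E] [NormedAddCommGroup F]
  [NormedSpace ℝ F] [NormedAddCommGroup G] [NormedSpace ℝ G] {α : ℝ≥0}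

lemma of_contDiffAt {g : E → F} {x : E} (hg : ContDiffAt ℝ 1 g x) : LocHolderAt 1 g x := by
  obtain ⟨K, t, ht, h⟩ := hg.exists_lipschitzOnWith
  exact ⟨K, t, ht, holderOnWith_one.2 h⟩

lemma fderiv_of_contDiffAt {g : E → F} {x : E} (hα : α ≤ 1) (hg : ContDiffAt ℝ 2 g x) :
    LocHolderAt α (fderiv ℝ g) x :=
  (of_contDiffAt (hg.fderiv_right (m := 1) (by norm_num))).mono hα

lemma fderiv_comp {g : F → G} {h : E → F} {x : E} (hg : ContDiffAt ℝ 1 g (h x))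
    (hh : ContDiffAt ℝ 1 h x) (hg' : LocHolderAt α (fderiv ℝ g) (h x))
    (hh' : LocHolderAt α (fderiv ℝ h) x) : LocHolderAt α (fderiv ℝ (g ∘ h)) x := by
  have h1 : LocHolderAt α (fun y => (fderiv ℝ g (h y), fderiv ℝ h y)) x := by
    have := (hg'.comp (of_contDiffAt hh) hh.continuousAt)
    rw [mul_one] at this
    exact this.prodMk hh'
  have hmul : LocHolderAt 1 (fun p : (F →L[ℝ] G) × (E →L[ℝ] F) => p.1.comp p.2)
      (fderiv ℝ g (h x), fderiv ℝ h x) :=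
    of_contDiffAt (isBoundedBilinearMap_comp.contDiff.contDiffAt)
  have hcont : ContinuousAt (fun y => (fderiv ℝ g (h y), fderiv ℝ h y)) x := by
    refine ContinuousAt.prodMk ?_ ?_
    · exact ContinuousAt.comp (g := fderiv ℝ g)
        (hg.fderiv_right (m := 0) (by norm_num)).continuousAt hh.continuousAt
    · exact (hh.fderiv_right (m := 0) (by norm_num)).continuousAt
  have h2 := LocHolderAt.comp (h := fun y => (fderiv ℝ g (h y), fderiv ℝ h y)) hmul h1 hcont
  rw [one_mul] at h2
  refine h2.congr ?_
  have e1 := hh.continuousAt.eventually (hg.eventually (by simp))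
  have e2 := hh.eventually (by simp)
  filter_upwards [e1, e2] with y hy1 hy2
  exact (_root_.fderiv_comp y (hy1.differentiableAt (by simp))
    (hy2.differentiableAt (by simp))).symm

end

end LocHolderAt

section Charts

variable {M : Type*} [TopologicalSpace M] [ChartedSpace (EuclideanSpace ℝ (Fin 2)) M]

/-- The map `g` read in the charts centred at `z` and `z'`. -/
def inCharts (g : M → M) (z z' : M) : Plane → Plane :=
  extChartAt (𝓡 2) z' ∘ g ∘ (extChartAt (𝓡 2) z).symm

lemma contDiffAt_coordChange [IsManifold (𝓡 2) 2 M] {z z' p : M}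
    (hz : p ∈ (extChartAt (𝓡 2) z).source) (hz' : p ∈ (extChartAt (𝓡 2) z').source) :
    ContDiffAt ℝ 2 (extChartAt (𝓡 2) z' ∘ (extChartAt (𝓡 2) z).symm) (extChartAt (𝓡 2) z p) := by
  have := contDiffWithinAt_ext_coord_change (I := 𝓡 2) (n := 2) z' z
    (y := extChartAt (𝓡 2) z p) ?_
  · rwa [ModelWithCorners.Boundaryless.range_eq_univ, contDiffWithinAt_univ] at this
  · rw [PartialEquiv.trans_source]
    refine ⟨(extChartAt (𝓡 2) z).map_source hz, ?_⟩
    rwa [mem_preimage, (extChartAt (𝓡 2) z).left_inv hz]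

lemma contDiffAt_inCharts [IsManifold (𝓡 2) 2 M] {g : M → M} (hg : ContMDiff (𝓡 2) (𝓡 2) 1 g)
    {z z' p : M} (hz : p ∈ (extChartAt (𝓡 2) z).source)
    (hz' : g p ∈ (extChartAt (𝓡 2) z').source) :
    ContDiffAt ℝ 1 (inCharts g z z') (extChartAt (𝓡 2) z p) := by
  have := (contMDiffAt_iff_of_mem_source (I := 𝓡 2) (I' := 𝓡 2) (n := 1) (x := z) (y := z')
    (f := g) (x' := p) (by simpa using hz) (by simpa using hz')).1 hg.contMDiffAt
  rw [ModelWithCorners.Boundaryless.range_eq_univ, contDiffWithinAt_univ] at this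
  exact this.2

/-- A diffeomorphism of class `C^{1+α}` has a locally Hölder differential in any pair of charts. -/
lemma locHolderAt_fderiv_inCharts [IsManifold (𝓡 2) 2 M] {f : Diffeomorph (𝓡 2) (𝓡 2) M M 1}
    {α : ℝ≥0} (hα : α ≤ 1) (hf : IsC1Holder f α) {z z' p : M}
    (hz : p ∈ (extChartAt (𝓡 2) z).source) (hz' : f p ∈ (extChartAt (𝓡 2) z').source) :
    LocHolderAt α (fderiv ℝ (inCharts f z z')) (extChartAt (𝓡 2) z p) := by
  have hsm : ContMDiff (𝓡 2) (𝓡 2) 1 f := f.contMDiff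
  have hp := mem_extChartAt_source (I := 𝓡 2) p
  have hfp := mem_extChartAt_source (I := 𝓡 2) (f p)
  set ψ := extChartAt (𝓡 2) p ∘ (extChartAt (𝓡 2) z).symm with hψ
  set ψ' := extChartAt (𝓡 2) z' ∘ (extChartAt (𝓡 2) (f p)).symm with hψ'
  have e1 : ψ (extChartAt (𝓡 2) z p) = extChartAt (𝓡 2) p p := by
    rw [hψ, Function.comp_apply, (extChartAt (𝓡 2) z).left_inv hz]
  have e2 : inCharts f p (f p) (extChartAt (𝓡 2) p p) = extChartAt (𝓡 2) (f p) (f p) := by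
    simp [inCharts]
  have c1 : ContDiffAt ℝ 2 ψ (extChartAt (𝓡 2) z p) := contDiffAt_coordChange hz hp
  have c2 : ContDiffAt ℝ 1 (inCharts f p (f p)) (extChartAt (𝓡 2) p p) :=
    contDiffAt_inCharts hsm hp hfp
  have c3 : ContDiffAt ℝ 2 ψ' (extChartAt (𝓡 2) (f p) (f p)) := contDiffAt_coordChange hfp hz'
  have hF : LocHolderAt α (fderiv ℝ (inCharts f p (f p))) (extChartAt (𝓡 2) p p) := hf p
  have h12 : LocHolderAt α (fderiv ℝ (inCharts f p (f p) ∘ ψ)) (extChartAt (𝓡 2) z p) :=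
    LocHolderAt.fderiv_comp (by rwa [e1]) (c1.of_le (by norm_num)) (by rwa [e1])
      (LocHolderAt.fderiv_of_contDiffAt hα c1)
  have c12 : ContDiffAt ℝ 1 (inCharts f p (f p) ∘ ψ) (extChartAt (𝓡 2) z p) :=
    ContDiffAt.comp _ (by rwa [e1]) (c1.of_le (by norm_num))
  have e12 : (inCharts f p (f p) ∘ ψ) (extChartAt (𝓡 2) z p) = extChartAt (𝓡 2) (f p) (f p) := by
    rw [Function.comp_apply, e1, e2]
  have h123 : LocHolderAt α (fderiv ℝ (ψ' ∘ inCharts f p (f p) ∘ ψ)) (extChartAt (𝓡 2) z p) :=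
    LocHolderAt.fderiv_comp (by rw [e12]; exact c3.of_le (by norm_num)) c12
      (by rw [e12]; exact LocHolderAt.fderiv_of_contDiffAt hα c3) h12
  refine h123.congr (Filter.EventuallyEq.fderiv ?_)
  have hsymm : Tendsto (extChartAt (𝓡 2) z).symm (𝓝 (extChartAt (𝓡 2) z p)) (𝓝 p) := by
    have := continuousAt_extChartAt_symm' (I := 𝓡 2) hz
    rwa [ContinuousAt, (extChartAt (𝓡 2) z).left_inv hz] at this
  have n1 := hsymm.eventually (extChartAt_source_mem_nhds (I := 𝓡 2) p)
  have n2 := hsymm.eventually (hsm.continuous.continuousAt.eventually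
    (extChartAt_source_mem_nhds (I := 𝓡 2) (f p)))
  filter_upwards [n1, n2] with y hy1 hy2
  simp only [hψ, hψ', inCharts, Function.comp_apply]
  rw [(extChartAt (𝓡 2) p).left_inv hy1, (extChartAt (𝓡 2) (f p)).left_inv hy2]

end Charts

section ChartDeriv

variable {M : Type*} [TopologicalSpace M] [ChartedSpace (EuclideanSpace ℝ (Fin 2)) M]

/-- The differential at `p` of the chart centred at `z`. -/
def chartDeriv (z p : M) : TangentSpace (𝓡 2) p →L[ℝ] Plane :=
  mfderiv (𝓡 2) 𝓘(ℝ, Plane) (extChartAt (𝓡 2) z) p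

variable [IsManifold (𝓡 2) 2 M] [RiemannianBundle (fun x : M => TangentSpace (𝓡 2) x)]
  [IsContinuousRiemannianBundle (EuclideanSpace ℝ (Fin 2)) (fun x : M => TangentSpace (𝓡 2) x)]

attribute [local instance] normedAddCommGroupTangentSpaceVectorSpace
  normedSpaceTangentSpaceVectorSpace in
lemma exists_chartDeriv_norm_le (z : M) :
    ∃ C > (0 : ℝ≥0), ∀ᶠ p in 𝓝 z, ‖chartDeriv z p‖ₑ ≤ C := by
  obtain ⟨C, hC, h⟩ := eventually_enorm_mfderiv_extChartAt_lt (𝓡 2) z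
  exact ⟨C, hC, h.mono fun p hp => hp.le⟩

attribute [local instance] normedAddCommGroupTangentSpaceVectorSpace
  normedSpaceTangentSpaceVectorSpace in
lemma exists_norm_le_chartDeriv (z : M) :
    ∃ C > 0, ∀ᶠ p in 𝓝 z, ∀ v : TangentSpace (𝓡 2) p, ‖v‖ ≤ C * ‖chartDeriv z p v‖ := by
  obtain ⟨C, hC, h⟩ := eventually_norm_symmL_trivializationAt_lt Plane
    (fun x : M => TangentSpace (𝓡 2) x) z
  refine ⟨C, hC, ?_⟩
  filter_upwards [h, chart_source_mem_nhds (EuclideanSpace ℝ (Fin 2)) z] with p hp hps v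
  have e : (trivializationAt Plane (fun x : M => TangentSpace (𝓡 2) x) z).symmL ℝ p
      (chartDeriv z p v) = v := by
    have h1 := TangentBundle.continuousLinearMapAt_trivializationAt (I := 𝓡 2) hps
    have h2 : chartDeriv z p v =
        (trivializationAt Plane (fun x : M => TangentSpace (𝓡 2) x) z).continuousLinearMapAt ℝ p v := by
      exact congr($h1.symm v)
    rw [h2]
    exact Trivialization.symmL_continuousLinearMapAt _ (by simpa using hps) _
  conv_lhs => rw [← e]
  exact (ContinuousLinearMap.le_opNorm _ _).trans (by gcongr)

end ChartDeriv

section PathLength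

variable {M : Type*} [EMetricSpace M] [ChartedSpace (EuclideanSpace ℝ (Fin 2)) M]
  [RiemannianBundle (fun x : M => TangentSpace (𝓡 2) x)]

/-- Along a path staying where the differential of a chart is bounded, the chart is controlled by
the length of the path. -/
lemma edist_extChartAt_le_pathELength [IsManifold (𝓡 2) 2 M] {z : M} {C : ℝ≥0} {γ : ℝ → M}
    (hγ : ContMDiff 𝓘(ℝ, ℝ) (𝓡 2) 1 γ)
    (hs : ∀ t ∈ Icc (0 : ℝ) 1, γ t ∈ (extChartAt (𝓡 2) z).source ∧ ‖chartDeriv z (γ t)‖ₑ ≤ C) :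
    edist (extChartAt (𝓡 2) z (γ 0)) (extChartAt (𝓡 2) z (γ 1)) ≤
      C * Manifold.pathELength (𝓡 2) γ 0 1 := by
  let γ' := extChartAt (𝓡 2) z ∘ γ
  have hC : ContMDiffOn 𝓘(ℝ, ℝ) 𝓘(ℝ, Plane) 1 γ' (Icc 0 1) :=
    (contMDiffOn_extChartAt (n := 1)).comp (I' := 𝓡 2)
      (t := (chartAt (EuclideanSpace ℝ (Fin 2)) z).source)
      hγ.contMDiffOn (fun t ht ↦ by simpa using (hs t ht).1)
  calc edist (extChartAt (𝓡 2) z (γ 0)) (extChartAt (𝓡 2) z (γ 1)) = ‖γ' 1 - γ' 0‖ₑ := by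
        rw [edist_comm, edist_eq_enorm_sub]; rfl
    _ ≤ ∫⁻ t in Icc (0 : ℝ) 1, ‖derivWithin γ' (Icc 0 1) t‖ₑ := by
      apply enorm_sub_le_lintegral_derivWithin_Icc_of_contDiffOn_Icc _ zero_le_one
      rwa [← contMDiffOn_iff_contDiffOn]
    _ ≤ ∫⁻ t in Icc (0 : ℝ) 1, C * ‖mfderivWithin 𝓘(ℝ, ℝ) (𝓡 2) γ (Icc 0 1) t 1‖ₑ := by
      apply MeasureTheory.setLIntegral_mono' measurableSet_Icc (fun t ht ↦ ?_)
      have h1 : mfderivWithin 𝓘(ℝ, ℝ) 𝓘(ℝ, Plane) γ' (Icc 0 1) t =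
          (mfderiv (𝓡 2) 𝓘(ℝ, Plane) (extChartAt (𝓡 2) z) (γ t)) ∘L
            (mfderivWithin 𝓘(ℝ, ℝ) (𝓡 2) γ (Icc 0 1) t) := by
        apply mfderiv_comp_mfderivWithin
        · exact mdifferentiableAt_extChartAt (by simpa using (hs t ht).1)
        · exact (hγ.mdifferentiable one_ne_zero).mdifferentiableOn _ ht
        · rw [uniqueMDiffWithinAt_iff_uniqueDiffWithinAt]
          exact uniqueDiffOn_Icc zero_lt_one _ ht
      have h2 : derivWithin γ' (Icc 0 1) t =
          chartDeriv z (γ t) (mfderivWithin 𝓘(ℝ, ℝ) (𝓡 2) γ (Icc 0 1) t 1) := by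
        rw [← fderivWithin_derivWithin, ← mfderivWithin_eq_fderivWithin]
        exact congr($h1 1)
      rw [h2]
      refine (ContinuousLinearMap.le_opENorm _ _).trans ?_
      gcongr
      exact (hs t ht).2
    _ = C * Manifold.pathELength (𝓡 2) γ 0 1 := by
      rw [MeasureTheory.lintegral_const_mul' _ _ ENNReal.coe_ne_top,
          Manifold.pathELength_eq_lintegral_mfderivWithin_Icc]

lemma edist_le_pathELength [IsRiemannianManifold (𝓡 2) M] {γ : ℝ → M}
    (hγ : ContMDiff 𝓘(ℝ, ℝ) (𝓡 2) 1 γ) {t : ℝ}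
    (ht : t ∈ Icc (0 : ℝ) 1) :
    edist (γ 0) (γ t) ≤ Manifold.pathELength (𝓡 2) γ 0 1 := by
  rw [IsRiemannianManifold.out (I := 𝓡 2) (γ 0) (γ t)]
  exact (Manifold.riemannianEDist_le_pathELength hγ.contMDiffOn rfl rfl ht.1).trans
    (Manifold.pathELength_mono le_rfl ht.2)

end PathLength

section Lipschitz

variable {M : Type*} [EMetricSpace M] [ChartedSpace (EuclideanSpace ℝ (Fin 2)) M]
  [IsManifold (𝓡 2) 2 M] [RiemannianBundle (fun x : M => TangentSpace (𝓡 2) x)]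
  [IsContinuousRiemannianBundle (EuclideanSpace ℝ (Fin 2)) (fun x : M => TangentSpace (𝓡 2) x)]
  [IsRiemannianManifold (𝓡 2) M]

/-- Charts are locally Lipschitz for the Riemannian distance. -/
lemma exists_lipschitzOnWith_extChartAt (z : M) :
    ∃ C : ℝ≥0, ∃ U ∈ 𝓝 z, LipschitzOnWith C (extChartAt (𝓡 2) z) U := by
  obtain ⟨C, -, hC⟩ := exists_chartDeriv_norm_le z
  obtain ⟨r, hr, hball⟩ := EMetric.mem_nhds_iff.1
    (inter_mem hC (extChartAt_source_mem_nhds (I := 𝓡 2) z))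
  have hr3 : 0 < r / 3 := ENNReal.div_pos hr.ne' (by norm_num)
  refine ⟨C, Metric.eball z (r / 3), Metric.eball_mem_nhds z hr3, fun p hp q hq => ?_⟩
  have hpz : edist p z < r / 3 := hp
  have hqz : edist q z < r / 3 := hq
  have hthird : r / 3 + r / 3 + r / 3 = r := ENNReal.add_thirds r
  have hpq : edist p q < r / 3 + r / 3 :=
    (edist_triangle_right p q z).trans_lt (ENNReal.add_lt_add hpz hqz)
  have key : ∀ ℓ : ℝ≥0∞, edist p q < ℓ → ℓ ≤ r / 3 + r / 3 →
      edist (extChartAt (𝓡 2) z p) (extChartAt (𝓡 2) z q) ≤ C * ℓ := by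
    intro ℓ hℓ hℓr
    have hℓ' := hℓ
    rw [IsRiemannianManifold.out (I := 𝓡 2) p q] at hℓ'
    obtain ⟨γ, rfl, rfl, hγ, hlen, -⟩ :=
      Manifold.exists_lt_locally_constant_of_riemannianEDist_lt hℓ' zero_lt_one
    refine (edist_extChartAt_le_pathELength hγ (C := C) fun t ht => ?_).trans (by gcongr)
    have hmem : γ t ∈ Metric.eball z r := by
      have h1 : edist (γ t) (γ 0) < r / 3 + r / 3 := by
        rw [edist_comm]
        exact ((edist_le_pathELength hγ ht).trans_lt hlen).trans_le hℓr
      calc edist (γ t) z ≤ edist (γ t) (γ 0) + edist (γ 0) z := edist_triangle _ _ _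
        _ < r / 3 + r / 3 + r / 3 := ENNReal.add_lt_add h1 hpz
        _ = r := hthird
    exact ⟨(hball hmem).2, (hball hmem).1⟩
  by_cases hC0 : C = 0
  · simpa [hC0] using key _ hpq le_rfl
  have hC0' : (C : ℝ≥0∞) ≠ 0 := by simpa using hC0
  rw [mul_comm, ← ENNReal.div_le_iff hC0' ENNReal.coe_ne_top]
  refine le_of_forall_gt_imp_ge_of_dense fun ℓ hℓ => ?_
  rw [ENNReal.div_le_iff hC0' ENNReal.coe_ne_top, mul_comm]
  exact (key _ (lt_min hℓ hpq) (min_le_right _ _)).trans (by gcongr; exact min_le_left _ _)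

end Lipschitz

open scoped Uniformity

/-- A map that is locally Hölder at the points of a compact set is uniformly so. -/
lemma exists_uniform_holder {X Y : Type*} [PseudoEMetricSpace X] [PseudoEMetricSpace Y]
    {K : Set X} (hK : IsCompact K) {α : ℝ≥0} {g : X → Y} (h : ∀ p ∈ K, LocHolderAt α g p) :
    ∃ C : ℝ≥0, ∀ᶠ pq : X × X in 𝓤 X, pq.1 ∈ K →
      edist (g pq.1) (g pq.2) ≤ C * edist pq.1 pq.2 ^ (α : ℝ) := by
  refine hK.induction_on (p := fun s => ∃ C : ℝ≥0, ∀ᶠ pq : X × X in 𝓤 X, pq.1 ∈ s →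
      edist (g pq.1) (g pq.2) ≤ C * edist pq.1 pq.2 ^ (α : ℝ)) ⟨0, by simp⟩ ?_ ?_ ?_
  · rintro s t hst ⟨C, hC⟩
    exact ⟨C, hC.mono fun pq h hs => h (hst hs)⟩
  · rintro s t ⟨C, hC⟩ ⟨D, hD⟩
    refine ⟨max C D, ?_⟩
    filter_upwards [hC, hD] with pq h1 h2 hpq
    rcases hpq with hpq | hpq
    · refine (h1 hpq).trans ?_
      gcongr; exact le_max_left _ _
    · refine (h2 hpq).trans ?_
      gcongr; exact le_max_right _ _
  · intro p hp
    obtain ⟨C, U, hU, hg⟩ := h p hp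
    obtain ⟨r, hr, hball⟩ := EMetric.mem_nhds_iff.1 hU
    have hr2 : 0 < r / 2 := ENNReal.half_pos hr.ne'
    refine ⟨Metric.eball p (r / 2), mem_nhdsWithin_of_mem_nhds (Metric.eball_mem_nhds p hr2),
      C, ?_⟩
    filter_upwards [edist_mem_uniformity hr2] with pq hpq hmem
    have hpq' : edist pq.2 pq.1 < r / 2 := by rw [edist_comm]; exact hpq
    have hmem' : edist pq.1 p < r / 2 := hmem
    refine hg _ (hball ?_) _ (hball ?_)
    · exact lt_of_lt_of_le hmem' ENNReal.half_le_self
    · calc edist pq.2 p ≤ edist pq.2 pq.1 + edist pq.1 p := edist_triangle _ _ _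
        _ < r / 2 + r / 2 := ENNReal.add_lt_add hpq' hmem'
        _ = r := ENNReal.add_halves r

lemma eventually_uniformity_mem_of_isCompact {X : Type*} [UniformSpace X] {K U : Set X}
    (hK : IsCompact K) (hU : IsOpen U) (hKU : K ⊆ U) :
    ∀ᶠ pq : X × X in 𝓤 X, pq.1 ∈ K → pq.2 ∈ U := by
  obtain ⟨V, hV, -, h⟩ := lebesgue_number_of_compact_open hK hU hKU
  filter_upwards [hV] with pq hpq hmem
  exact h _ hmem hpq

section Selection

variable {M : Type*} [EMetricSpace M] [ChartedSpace (EuclideanSpace ℝ (Fin 2)) M]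
  [IsManifold (𝓡 2) 2 M] [RiemannianBundle (fun x : M => TangentSpace (𝓡 2) x)]
  [IsContinuousRiemannianBundle (EuclideanSpace ℝ (Fin 2)) (fun x : M => TangentSpace (𝓡 2) x)]
  [IsRiemannianManifold (𝓡 2) M]

/-- The chart centred at `z` distorts tangent vectors at `q` by at most the factor `C`. -/
def HasChartBound (C : ℝ≥0) (z q : M) : Prop :=
  ∀ v : TangentSpace (𝓡 2) q, ‖chartDeriv z q v‖ ≤ C * ‖v‖ ∧ ‖v‖ ≤ C * ‖chartDeriv z q v‖

lemma exists_chart_domain (z : M) :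
    ∃ C : ℝ≥0, ∃ U : Set M, IsOpen U ∧ z ∈ U ∧ ∀ p ∈ U, p ∈ (extChartAt (𝓡 2) z).source ∧
      HasChartBound C z p ∧ LocHolderAt 1 (extChartAt (𝓡 2) z) p := by
  obtain ⟨C₁, -, h1⟩ := exists_chartDeriv_norm_le z
  obtain ⟨C₂, hC₂, h2⟩ := exists_norm_le_chartDeriv z
  obtain ⟨L, W, hW, hL⟩ := exists_lipschitzOnWith_extChartAt z
  lift C₂ to ℝ≥0 using hC₂.le
  have hev : ∀ᶠ p in 𝓝 z, p ∈ (extChartAt (𝓡 2) z).source ∧ HasChartBound (max C₁ C₂) z p ∧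
      LocHolderAt 1 (extChartAt (𝓡 2) z) p := by
    filter_upwards [h1, h2, extChartAt_source_mem_nhds (I := 𝓡 2) z,
      eventually_mem_nhds_iff.2 hW] with p hp1 hp2 hps hpW
    refine ⟨hps, fun v => ⟨?_, (hp2 v).trans ?_⟩, L, W, hpW, holderOnWith_one.2 hL⟩
    · have hn : ‖chartDeriv z p‖ ≤ C₁ := by
        exact_mod_cast (ENNReal.coe_le_coe.1 hp1 : ‖chartDeriv z p‖₊ ≤ C₁)
      refine (ContinuousLinearMap.le_opNorm _ _).trans ?_
      gcongr
      exact hn.trans (by exact_mod_cast le_max_left C₁ C₂)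
    · gcongr
      exact_mod_cast le_max_right C₁ C₂
  obtain ⟨U, hU, hUo, hzU⟩ := mem_nhds_iff.1 hev
  exact ⟨_, U, hUo, hzU, hU⟩

/-- On a compact surface one can select, for each point `p`, a chart which is uniformly controlled
near `p`, and in which the differential of `f` is uniformly Hölder. -/
theorem exists_chart_selection [CompactSpace M] {f : Diffeomorph (𝓡 2) (𝓡 2) M M 1} {α : ℝ≥0}
    (hα : α ≤ 1) (hf : IsC1Holder f α) :
    ∃ (c : M → M) (C : ℝ≥0), ∀ᶠ pq : M × M in 𝓤 M,
      pq.2 ∈ (extChartAt (𝓡 2) (c pq.1)).source ∧ HasChartBound C (c pq.1) pq.2 ∧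
      edist (fderiv ℝ (inCharts f (c pq.1) (c (f pq.1))) (extChartAt (𝓡 2) (c pq.1) pq.1))
        (fderiv ℝ (inCharts f (c pq.1) (c (f pq.1))) (extChartAt (𝓡 2) (c pq.1) pq.2)) ≤
        C * edist pq.1 pq.2 ^ (α : ℝ) := by
  choose C₁ U hUo hzU hU using exists_chart_domain (M := M)
  have hK : ∀ z : M, ∃ K ∈ 𝓝 z, K ⊆ U z ∧ IsCompact K := fun z =>
    local_compact_nhds ((hUo z).mem_nhds (hzU z))
  choose K hKn hKU hKc using hK
  obtain ⟨T, -, hT⟩ := isCompact_univ.elim_nhds_subcover K (fun z _ => hKn z)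
  have hc : ∀ p : M, ∃ z ∈ T, p ∈ K z := fun p => by simpa using hT (mem_univ p)
  choose c hcT hcK using hc
  have hcont : Continuous f := f.contMDiff.continuous
  have hunif : ∀ z z' : M, ∃ C : ℝ≥0, ∀ᶠ pq : M × M in 𝓤 M, pq.1 ∈ K z ∩ f ⁻¹' K z' →
      edist (fderiv ℝ (inCharts f z z') (extChartAt (𝓡 2) z pq.1))
        (fderiv ℝ (inCharts f z z') (extChartAt (𝓡 2) z pq.2)) ≤
        C * edist pq.1 pq.2 ^ (α : ℝ) := by
    intro z z'
    refine exists_uniform_holder (g := fun p => fderiv ℝ (inCharts f z z') (extChartAt (𝓡 2) z p))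
      ((hKc z).inter_right ((hKc z').isClosed.preimage hcont)) (fun p hp => ?_)
    obtain ⟨hp1, -, hp3⟩ := hU z p (hKU z hp.1)
    have hp2 := (hU z' (f p) (hKU z' hp.2)).1
    have := (locHolderAt_fderiv_inCharts hα hf hp1 hp2).comp hp3 (continuousAt_extChartAt' hp1)
    rwa [mul_one] at this
  choose C₂ hC₂ using hunif
  refine ⟨c, ∑ z ∈ T, C₁ z + ∑ z ∈ T, ∑ z' ∈ T, C₂ z z', ?_⟩
  have hle1 : ∀ z ∈ T, C₁ z ≤ ∑ z ∈ T, C₁ z + ∑ z ∈ T, ∑ z' ∈ T, C₂ z z' := fun z hz =>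
    (Finset.single_le_sum (f := C₁) (fun _ _ => zero_le) hz).trans
      (le_add_of_nonneg_right zero_le)
  have hle2 : ∀ z ∈ T, ∀ z' ∈ T, C₂ z z' ≤ ∑ z ∈ T, C₁ z + ∑ z ∈ T, ∑ z' ∈ T, C₂ z z' :=
    fun z hz z' hz' => ((Finset.single_le_sum (f := C₂ z) (fun _ _ => zero_le) hz').trans
      (Finset.single_le_sum (f := fun z => ∑ z' ∈ T, C₂ z z') (fun _ _ => zero_le) hz)).trans
      (le_add_of_nonneg_left zero_le)
  have e1 : ∀ᶠ pq : M × M in 𝓤 M, ∀ z ∈ T, pq.1 ∈ K z → pq.2 ∈ U z :=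
    (Filter.eventually_all_finset T).2 fun z _ =>
      eventually_uniformity_mem_of_isCompact (hKc z) (hUo z) (hKU z)
  have e2 := (Filter.eventually_all_finset T).2 fun z _ =>
    (Filter.eventually_all_finset T).2 fun z' _ => hC₂ z z'
  filter_upwards [e1, e2] with pq h1 h2
  obtain ⟨hs, hb, -⟩ := hU _ _ (h1 (c pq.1) (hcT _) (hcK _))
  refine ⟨hs, fun v => ⟨(hb v).1.trans ?_, (hb v).2.trans ?_⟩,
    (h2 _ (hcT _) _ (hcT (f pq.1)) ⟨hcK _, hcK _⟩).trans ?_⟩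
  · gcongr; exact_mod_cast hle1 _ (hcT _)
  · gcongr; exact_mod_cast hle1 _ (hcT _)
  · gcongr; exact_mod_cast hle2 _ (hcT _) _ (hcT _)

end Selection

section Orbits

variable {M : Type*} [TopologicalSpace M] [ChartedSpace (EuclideanSpace ℝ (Fin 2)) M]
  (f : Diffeomorph (𝓡 2) (𝓡 2) M M 1)

/-- The differential of a map from a surface to the plane. -/
def planeDiff (g : M → Plane) (p : M) : TangentSpace (𝓡 2) p →L[ℝ] Plane :=
  mfderiv (𝓡 2) 𝓘(ℝ, Plane) g p

lemma iter_succ (n : ℕ) : iter f (n + 1 : ℕ) = f ∘ iter f n := by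
  ext p
  simp only [iter, zpow_natCast, pow_succ', Function.comp_apply]
  rfl

lemma iter_zero : iter f 0 = id := by
  ext p; simp [iter]

lemma iter_neg (n : ℕ) : iter f (-n) = iter f.symm n := by
  ext p
  simp only [iter, zpow_neg, zpow_natCast, ← inv_pow]
  rfl

lemma contMDiff_iter_nat (n : ℕ) : ContMDiff (𝓡 2) (𝓡 2) 1 (iter f n) := by
  induction n with
  | zero => rw [Nat.cast_zero, iter_zero]; exact contMDiff_id
  | succ n ih => rw [iter_succ]; exact f.contMDiff.comp ih

lemma D_injective (n : ℕ) (p : M) : Function.Injective (D f n p) := by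
  have h1 : MDifferentiableAt (𝓡 2) (𝓡 2) (iter f n) p :=
    (contMDiff_iter_nat f n).mdifferentiable one_ne_zero p
  have h2 : MDifferentiableAt (𝓡 2) (𝓡 2) (iter f (-n)) (iter f n p) := by
    rw [iter_neg]; exact (contMDiff_iter_nat f.symm n).mdifferentiable one_ne_zero _
  have h3 : iter f (-n) ∘ iter f n = id := by
    ext q
    simp [iter]
  have h4 := mfderiv_comp p h2 h1
  have h5 : mfderiv (𝓡 2) (𝓡 2) (iter f (-n) ∘ iter f n) p =
      mfderiv (𝓡 2) (𝓡 2) (id : M → M) p := by rw [h3]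
  intro v w hvw
  have hv : mfderiv (𝓡 2) (𝓡 2) (iter f (-n)) (iter f n p) (D f n p v) = v :=
    congr($(h4.symm.trans (h5.trans mfderiv_id)) v)
  have hw : mfderiv (𝓡 2) (𝓡 2) (iter f (-n)) (iter f n p) (D f n p w) = w :=
    congr($(h4.symm.trans (h5.trans mfderiv_id)) w)
  rw [← hv, ← hw, hvw]

variable {f}

lemma planeDiff_comp_iter {n : ℕ} {z p : M}
    [IsManifold (𝓡 2) 2 M]
    (hz : iter f n p ∈ (extChartAt (𝓡 2) z).source) (v : TangentSpace (𝓡 2) p) :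
    planeDiff (extChartAt (𝓡 2) z ∘ iter f n) p v =
      chartDeriv z (iter f n p) (D f n p v) := by
  have h := mfderiv_comp p (I := 𝓡 2) (I' := 𝓡 2) (I'' := 𝓘(ℝ, Plane))
    (mdifferentiableAt_extChartAt (x := z) (by simpa using hz))
    ((contMDiff_iter_nat f n).mdifferentiable one_ne_zero p)
  exact congr($h v)

lemma planeDiff_succ [IsManifold (𝓡 2) 2 M] {n : ℕ} {z z' p : M}
    (hz : iter f n p ∈ (extChartAt (𝓡 2) z).source)
    (hz' : iter f (n + 1 : ℕ) p ∈ (extChartAt (𝓡 2) z').source) (v : TangentSpace (𝓡 2) p) :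
    planeDiff (extChartAt (𝓡 2) z' ∘ iter f (n + 1 : ℕ)) p v =
      fderiv ℝ (inCharts f z z') (extChartAt (𝓡 2) z (iter f n p))
        (planeDiff (extChartAt (𝓡 2) z ∘ iter f n) p v) := by
  rw [iter_succ] at hz' ⊢
  have hcont : ContinuousAt (iter f n) p := (contMDiff_iter_nat f n).continuous.continuousAt
  have he : extChartAt (𝓡 2) z' ∘ f ∘ iter f n =ᶠ[𝓝 p]
      inCharts f z z' ∘ (extChartAt (𝓡 2) z ∘ iter f n) := by
    filter_upwards [hcont.eventually (extChartAt_source_mem_nhds' (I := 𝓡 2) hz)] with q hq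
    simp only [inCharts, Function.comp_apply, (extChartAt (𝓡 2) z).left_inv hq]
  have h1 : MDifferentiableAt (𝓡 2) 𝓘(ℝ, Plane) (extChartAt (𝓡 2) z ∘ iter f n) p :=
    (mdifferentiableAt_extChartAt (x := z) (by simpa using hz)).comp p
      ((contMDiff_iter_nat f n).mdifferentiable one_ne_zero p)
  have h2 : MDifferentiableAt 𝓘(ℝ, Plane) 𝓘(ℝ, Plane) (inCharts f z z')
      ((extChartAt (𝓡 2) z ∘ iter f n) p) :=
    ((contDiffAt_inCharts f.contMDiff hz hz').differentiableAt one_ne_zero).mdifferentiableAt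
  have h3 := he.mfderiv_eq (I := 𝓡 2) (I' := 𝓘(ℝ, Plane))
  rw [mfderiv_comp p h2 h1, mfderiv_eq_fderiv] at h3
  exact congr($h3 v)

end Orbits

section Rates

/-- The sequence `g` grows at most at the exponential rate `l`. -/
def UpperRate (g : ℕ → ℝ) (l : ℝ) : Prop :=
  ∀ ε > 0, ∀ᶠ n : ℕ in atTop, g n ≤ Real.exp ((l + ε) * n)

/-- The sequence `g` grows at least at the exponential rate `l`. -/
def LowerRate (g : ℕ → ℝ) (l : ℝ) : Prop :=
  ∀ ε > 0, ∀ᶠ n : ℕ in atTop, Real.exp ((l - ε) * n) ≤ g n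

lemma eventually_le_exp_mul (C : ℝ) {ε : ℝ} (hε : 0 < ε) :
    ∀ᶠ n : ℕ in atTop, C ≤ Real.exp (ε * n) := by
  have : Tendsto (fun n : ℕ => Real.exp (ε * n)) atTop atTop :=
    Real.tendsto_exp_atTop.comp (tendsto_natCast_atTop_atTop.const_mul_atTop hε)
  exact this.eventually_ge_atTop C

lemma UpperRate.of_le {g h : ℕ → ℝ} {l C : ℝ} (hg : UpperRate g l) (hC : 0 ≤ C)
    (hle : ∀ᶠ n in atTop, h n ≤ C * g n) : UpperRate h l := by
  intro ε hε
  filter_upwards [hg (ε / 2) (by positivity), hle, eventually_le_exp_mul C (half_pos hε)]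
    with n h1 h2 h3
  calc h n ≤ C * g n := h2
    _ ≤ C * Real.exp ((l + ε / 2) * n) := by gcongr
    _ ≤ Real.exp (ε / 2 * n) * Real.exp ((l + ε / 2) * n) := by gcongr
    _ = _ := by rw [← Real.exp_add]; congr 1; ring

lemma LowerRate.of_le {g h : ℕ → ℝ} {l C : ℝ} (hg : LowerRate g l) (hC : 0 < C)
    (hle : ∀ᶠ n in atTop, g n ≤ C * h n) : LowerRate h l := by
  intro ε hε
  filter_upwards [hg (ε / 2) (by positivity), hle, eventually_le_exp_mul C (half_pos hε)]
    with n h1 h2 h3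
  have h4 : Real.exp ((l - ε) * n) * Real.exp (ε / 2 * n) = Real.exp ((l - ε / 2) * n) := by
    rw [← Real.exp_add]; congr 1; ring
  have h5 : C * Real.exp ((l - ε) * n) ≤ C * h n :=
    calc C * Real.exp ((l - ε) * n) ≤ Real.exp (ε / 2 * n) * Real.exp ((l - ε) * n) := by gcongr
      _ = Real.exp ((l - ε / 2) * n) := by rw [mul_comm, h4]
      _ ≤ _ := h1.trans h2
  exact le_of_mul_le_mul_left h5 hC

lemma UpperRate.mono {g : ℕ → ℝ} {l m : ℝ} (hg : UpperRate g l) (h : l ≤ m) : UpperRate g m := by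
  intro ε hε
  filter_upwards [hg ε hε] with n hn
  exact hn.trans (by gcongr)

lemma upperRate_zero (l : ℝ) : UpperRate (fun _ => 0) l := fun _ _ =>
  Eventually.of_forall fun _ => (Real.exp_pos _).le

lemma UpperRate.sum {ι : Type*} {s : Finset ι} {g : ι → ℕ → ℝ} {l : ℝ}
    (h : ∀ i ∈ s, UpperRate (g i) l) : UpperRate (fun n => ∑ i ∈ s, g i n) l := by
  intro ε hε
  have h1 := (Filter.eventually_all_finset s).2 fun i hi => h i hi (ε / 2) (half_pos hε)
  filter_upwards [h1, eventually_le_exp_mul s.card (half_pos hε)] with n h1 h3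
  calc ∑ i ∈ s, g i n ≤ ∑ i ∈ s, Real.exp ((l + ε / 2) * n) := Finset.sum_le_sum h1
    _ = s.card * Real.exp ((l + ε / 2) * n) := by simp
    _ ≤ Real.exp (ε / 2 * n) * Real.exp ((l + ε / 2) * n) := by gcongr
    _ = _ := by rw [← Real.exp_add]; congr 1; ring

lemma LowerRate.sub {g h : ℕ → ℝ} {l m : ℝ} (hg : LowerRate g l) (hh : UpperRate h m)
    (hml : m < l) : LowerRate (fun n => g n - h n) l := by
  refine LowerRate.of_le (g := g) (C := 2) hg two_pos ?_
  have hδ : 0 < (l - m) / 3 := by linarith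
  filter_upwards [hg _ hδ, hh _ hδ, eventually_le_exp_mul 2 hδ] with n h1 h2 h3
  have h4 : Real.exp ((l - m) / 3 * n) * Real.exp ((m + (l - m) / 3) * n) =
      Real.exp ((l - (l - m) / 3) * n) := by
    rw [← Real.exp_add]; congr 1; ring
  have h5 : 2 * Real.exp ((m + (l - m) / 3) * n) ≤
      Real.exp ((l - m) / 3 * n) * Real.exp ((m + (l - m) / 3) * n) := by gcongr
  linarith

lemma LowerRate.sub_sum {ι : Type*} {s : Finset ι} {g : ℕ → ℝ} {h : ι → ℕ → ℝ} {l : ℝ}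
    (hg : LowerRate g l) (hh : ∀ i ∈ s, ∃ m < l, UpperRate (h i) m) :
    LowerRate (fun n => g n - ∑ i ∈ s, h i n) l := by
  classical
  induction s using Finset.induction_on with
  | empty => simpa using hg
  | insert i s hi ih =>
    obtain ⟨m, hm, hu⟩ := hh i (Finset.mem_insert_self i s)
    have := (ih fun j hj => hh j (Finset.mem_insert_of_mem hj)).sub hu hm
    refine LowerRate.of_le this one_pos (Eventually.of_forall fun n => ?_)
    rw [Finset.sum_insert hi]
    linarith

lemma tendsto_log_div_of_rates {g : ℕ → ℝ} {l : ℝ} (hu : UpperRate g l) (hl : LowerRate g l) :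
    Tendsto (fun n : ℕ => Real.log (g n) / n) atTop (𝓝 l) := by
  rw [Metric.tendsto_atTop']
  intro ε hε
  refine eventually_atTop.1 ?_ |>.imp fun N hN n hn => hN n hn.le
  filter_upwards [hu (ε / 2) (half_pos hε), hl (ε / 2) (half_pos hε), eventually_gt_atTop 0]
    with n h1 h2 hn
  have hn' : (0 : ℝ) < n := by exact_mod_cast hn
  have hpos : 0 < g n := (Real.exp_pos _).trans_le h2
  have h3 : Real.log (g n) ≤ (l + ε / 2) * n := (Real.log_le_iff_le_exp hpos).2 h1
  have h4 : (l - ε / 2) * n ≤ Real.log (g n) := (Real.le_log_iff_exp_le hpos).2 h2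
  rw [Real.dist_eq, abs_sub_lt_iff]
  have h5 : Real.log (g n) / n ≤ l + ε / 2 := (div_le_iff₀ hn').2 h3
  have h6 : l - ε / 2 ≤ Real.log (g n) / n := (le_div_iff₀ hn').2 h4
  constructor <;> linarith

lemma rates_of_tendsto {g : ℕ → ℝ} (hpos : ∀ n, 0 < g n) {l : ℝ}
    (h : Tendsto (fun n : ℕ => Real.log (g n) / n) atTop (𝓝 l)) :
    UpperRate g l ∧ LowerRate g l := by
  constructor
  · intro ε hε
    filter_upwards [h.eventually_le_const (by linarith : l < l + ε), eventually_gt_atTop 0]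
      with n hn hn0
    exact (Real.log_le_iff_le_exp (hpos n)).1 ((div_le_iff₀ (by exact_mod_cast hn0)).1 hn)
  · intro ε hε
    filter_upwards [h.eventually_const_le (by linarith : l - ε < l), eventually_gt_atTop 0]
      with n hn hn0
    exact (Real.le_log_iff_exp_le (hpos n)).1 ((le_div_iff₀ (by exact_mod_cast hn0)).1 hn)

lemma rates_of_tendsto_int {g : ℤ → ℝ} (hpos : ∀ n : ℕ, 0 < g n) {l : ℝ}
    (h : Tendsto (fun n : ℤ => (1 / (n : ℝ)) * Real.log (g n)) atTop (𝓝 l)) :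
    UpperRate (fun n => g n) l ∧ LowerRate (fun n => g n) l := by
  refine rates_of_tendsto hpos ?_
  refine (h.comp tendsto_natCast_atTop_atTop).congr fun n => ?_
  simp [div_eq_inv_mul]

lemma limsup_log_eq {g : ℕ → ℝ≥0∞} {g' : ℕ → ℝ} (hg : ∀ n, g n = ENNReal.ofReal (g' n)) {l : ℝ}
    (hu : UpperRate g' l) (hl : LowerRate g' l) :
    limsup (fun n : ℕ => ENNReal.log (g n) / (n : EReal)) atTop = l := by
  have h1 : Tendsto (fun n : ℕ => ((Real.log (g' n) / n : ℝ) : EReal)) atTop (𝓝 (l : EReal)) :=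
    (continuous_coe_real_ereal.tendsto l).comp (tendsto_log_div_of_rates hu hl)
  refine (h1.congr' ?_).limsup_eq
  filter_upwards [hl 1 one_pos] with n hn
  rw [hg, ENNReal.log_ofReal_of_pos ((Real.exp_pos _).trans_le hn), EReal.coe_div]
  simp

lemma exists_edist_le_of_limsup_neg {d : ℕ → ℝ≥0∞}
    (h : limsup (fun n : ℕ => ENNReal.log (d n) / (n : EReal)) atTop < 0) :
    ∃ δ > 0, ∀ᶠ n : ℕ in atTop, d n ≤ ENNReal.ofReal (Real.exp (-δ * n)) := by
  obtain ⟨r, hr1, hr2⟩ := EReal.lt_iff_exists_real_btwn.1 h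
  refine ⟨-r, by simpa using hr2, ?_⟩
  filter_upwards [eventually_lt_of_limsup_lt hr1, eventually_gt_atTop 0] with n hn hn0
  have hn' : (0 : EReal) < (n : EReal) := by exact_mod_cast hn0
  rw [EReal.div_lt_iff hn' (EReal.natCast_ne_top n)] at hn
  rw [neg_neg, ← ENNReal.log_le_log_iff, ENNReal.log_ofReal_of_pos (Real.exp_pos _), Real.log_exp]
  refine hn.le.trans (le_of_eq ?_)
  simp

end Rates

section Gram

variable {W : Type*} [NormedAddCommGroup W] [InnerProductSpace ℝ W]

lemma norm_sq_mul_norm_sq_sub_inner_sq_le (w₁ w₂ : W) (t : ℝ) :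
    ‖w₁‖ ^ 2 * ‖w₂‖ ^ 2 - inner ℝ w₁ w₂ ^ 2 ≤ ‖w₁‖ ^ 2 * ‖w₂ - t • w₁‖ ^ 2 := by
  rw [norm_sub_sq_real, inner_smul_right, norm_smul, mul_pow, Real.norm_eq_abs, sq_abs,
    real_inner_comm]
  nlinarith [sq_nonneg (t * ‖w₁‖ ^ 2 - inner ℝ w₂ w₁)]

/-- A linear map to the plane contracting by at most `C` contracts areas by at most `C ^ 2`. -/
lemma gram_le_wedge_sq {C : ℝ} (L : W →ₗ[ℝ] Plane) (hL : ∀ w, ‖w‖ ≤ C * ‖L w‖) (w₁ w₂ : W) :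
    ‖w₁‖ ^ 2 * ‖w₂‖ ^ 2 - inner ℝ w₁ w₂ ^ 2 ≤ (C ^ 2 * wedge (L w₁) (L w₂)) ^ 2 := by
  by_cases h0 : L w₁ = 0
  · have : w₁ = 0 := by
      have := hL w₁
      rw [h0, norm_zero, mul_zero] at this
      exact norm_le_zero_iff.1 this
    simp [this, wedge]
  have hn : ‖L w₁‖ ^ 2 ≠ 0 := by simpa using h0
  set t := inner ℝ (L w₂) (L w₁) / ‖L w₁‖ ^ 2 with ht
  refine (norm_sq_mul_norm_sq_sub_inner_sq_le w₁ w₂ t).trans ?_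
  have h1 : ‖w₁‖ ^ 2 ≤ (C * ‖L w₁‖) ^ 2 := by gcongr; exact hL _
  have h2 : ‖w₂ - t • w₁‖ ^ 2 ≤ (C * ‖L w₂ - t • L w₁‖) ^ 2 := by
    gcongr
    simpa using hL (w₂ - t • w₁)
  calc ‖w₁‖ ^ 2 * ‖w₂ - t • w₁‖ ^ 2 ≤ (C * ‖L w₁‖) ^ 2 * (C * ‖L w₂ - t • L w₁‖) ^ 2 := by
        gcongr
    _ = C ^ 4 * (‖L w₁‖ ^ 2 * ‖L w₂ - t • L w₁‖ ^ 2) := by ring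
    _ = C ^ 4 * (‖L w₁‖ ^ 2 * ‖L w₂‖ ^ 2 - inner ℝ (L w₁) (L w₂) ^ 2) := by
      rw [norm_sub_sq_real, inner_smul_right, norm_smul, mul_pow, Real.norm_eq_abs, sq_abs,
        real_inner_comm (L w₂) (L w₁), ht]
      field_simp
      ring
    _ = _ := by rw [← wedge_sq_add_inner_sq]; ring

lemma exists_det_gram_eq {n : ℕ} (hn : n = 2) :
    ∃ i j : Fin n, ∀ w : Fin n → W,
      Matrix.det (Matrix.of fun i j => (inner ℝ (w i) (w j) : ℝ)) =
        ‖w i‖ ^ 2 * ‖w j‖ ^ 2 - inner ℝ (w i) (w j) ^ 2 := by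
  subst hn
  refine ⟨0, 1, fun w => ?_⟩
  rw [Matrix.det_fin_two]
  simp only [Matrix.of_apply, real_inner_self_eq_norm_sq, real_inner_comm (w 0) (w 1)]
  ring

variable {V : Type*} [NormedAddCommGroup V] [InnerProductSpace ℝ V] [FiniteDimensional ℝ V]

lemma linJac_pos {A : V →L[ℝ] W} (hA : Function.Injective A) : 0 < linJac A := by
  refine Real.sqrt_pos.2 ?_
  have h : LinearIndependent ℝ (fun i => A (stdOrthonormalBasis ℝ V i)) :=
    (stdOrthonormalBasis ℝ V).orthonormal.linearIndependent.map'
      (A : V →ₗ[ℝ] W) (LinearMap.ker_eq_bot.2 hA)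
  exact (Matrix.posDef_gram_of_linearIndependent h).det_pos

/-- The Jacobian of a linear map on a plane is controlled by the area spanned by the images of two
fixed vectors. -/
lemma exists_linJac_le (hV : Module.finrank ℝ V = 2) {e₁ e₂ : V}
    (he : LinearIndependent ℝ ![e₁, e₂]) :
    ∃ K > 0, ∀ {W : Type*} [NormedAddCommGroup W] [InnerProductSpace ℝ W] (A : V →L[ℝ] W) (C : ℝ)
      (L : W →ₗ[ℝ] Plane), (∀ w, ‖w‖ ≤ C * ‖L w‖) →
      linJac A ≤ K * C ^ 2 * |wedge (L (A e₁)) (L (A e₂))| := by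
  have hspan : ∀ v : V, ∃ s t : ℝ, s • e₁ + t • e₂ = v := by
    intro v
    have htop := he.span_eq_top_of_card_eq_finrank (by simp [hV])
    have hv : v ∈ Submodule.span ℝ (Set.range ![e₁, e₂]) := by rw [htop]; trivial
    rw [Matrix.range_cons, Matrix.range_cons, Matrix.range_empty, Set.union_empty,
      Set.singleton_union, Submodule.mem_span_pair] at hv
    exact hv
  choose s t hst using hspan
  set o := stdOrthonormalBasis ℝ V
  refine ⟨1 + ∑ i, ∑ j, |s (o i) * t (o j) - t (o i) * s (o j)|, by positivity, ?_⟩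
  intro W _ _ A C L hL
  obtain ⟨i, j, hij⟩ := exists_det_gram_eq (W := W) hV
  have hw : wedge (L (A (o i))) (L (A (o j))) =
      (s (o i) * t (o j) - t (o i) * s (o j)) * wedge (L (A e₁)) (L (A e₂)) := by
    conv_lhs => rw [← hst (o i), ← hst (o j)]
    simp only [map_add, map_smul, wedge, PiLp.add_apply, PiLp.smul_apply, smul_eq_mul]
    ring
  rw [linJac, hij (fun i => A (o i))]
  refine (Real.sqrt_le_sqrt (gram_le_wedge_sq L hL _ _)).trans ?_
  rw [Real.sqrt_sq_eq_abs, hw, abs_mul, abs_mul, abs_of_nonneg (sq_nonneg C)]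
  have h1 : |s (o i) * t (o j) - t (o i) * s (o j)| ≤
      1 + ∑ i, ∑ j, |s (o i) * t (o j) - t (o i) * s (o j)| := by
    have h2 := Finset.single_le_sum
      (f := fun j => |s (o i) * t (o j) - t (o i) * s (o j)|)
      (fun _ _ => abs_nonneg _) (Finset.mem_univ j)
    have h3 := Finset.single_le_sum
      (f := fun i => ∑ j, |s (o i) * t (o j) - t (o i) * s (o j)|)
      (fun _ _ => Finset.sum_nonneg fun _ _ => abs_nonneg _) (Finset.mem_univ i)
    linarith
  calc C ^ 2 * (|s (o i) * t (o j) - t (o i) * s (o j)| * |wedge (L (A e₁)) (L (A e₂))|)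
      = |s (o i) * t (o j) - t (o i) * s (o j)| * C ^ 2 * |wedge (L (A e₁)) (L (A e₂))| := by ring
    _ ≤ _ := by gcongr

end Gram

section Dimension

variable {M : Type*} [TopologicalSpace M] [ChartedSpace (EuclideanSpace ℝ (Fin 2)) M]

lemma finrank_tangentSpace (x : M) : Module.finrank ℝ (TangentSpace (𝓡 2) x) = 2 :=
  finrank_euclideanSpace_fin (𝕜 := ℝ) (n := 2)

end Dimension

lemma sum_finrank_of_isInternal {V : Type*} [AddCommGroup V] [Module ℝ V] [FiniteDimensional ℝ V]
    {ι : Type*} [Fintype ι] [DecidableEq ι] {H : ι → Submodule ℝ V} (h : DirectSum.IsInternal H) :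
    ∑ i, Module.finrank ℝ (H i) = Module.finrank ℝ V := by
  rw [Module.finrank_eq_card_basis (h.collectedBasis fun i => Module.finBasis ℝ (H i))]
  simp

lemma linearIndependent_pair_of_disjoint {V : Type*} [AddCommGroup V] [Module ℝ V]
    {P Q : Submodule ℝ V} (h : Disjoint P Q) {e₁ e₂ : V} (h1 : e₁ ∈ P) (h2 : e₂ ∈ Q)
    (n1 : e₁ ≠ 0) (n2 : e₂ ≠ 0) : LinearIndependent ℝ ![e₁, e₂] := by
  refine LinearIndependent.pair_iff.2 fun s t hst => ?_
  have hs : s • e₁ = 0 := by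
    refine (Submodule.disjoint_def.1 h) _ (P.smul_mem s h1) ?_
    rw [eq_neg_of_add_eq_zero_left hst]
    exact Q.neg_mem (Q.smul_mem t h2)
  rw [hs, zero_add] at hst
  exact ⟨(smul_eq_zero.1 hs).resolve_right n1, (smul_eq_zero.1 hst).resolve_right n2⟩

/-- If the dimensions `d` of the summands add up to two, two nontrivial summands are all that is
seen by a weighted sum. -/
lemma sum_mul_eq_of_sum_eq_two {ι : Type*} [Fintype ι] {d : ι → ℕ} (hd : ∑ i, d i = 2)
    {i j : ι} (hij : i ≠ j) (hi : d i ≠ 0) (hj : d j ≠ 0) (l : ι → ℝ) :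
    ∑ k, (d k : ℝ) * l k = l i + l j := by
  classical
  have hpair : ∑ k ∈ {i, j}, d k + ∑ k ∈ Finset.univ \ {i, j}, d k = 2 := by
    rw [add_comm, Finset.sum_sdiff (Finset.subset_univ _), hd]
  rw [Finset.sum_pair hij] at hpair
  have hzero : ∑ k ∈ Finset.univ \ {i, j}, d k = 0 := by omega
  have h0 : ∀ k ∈ Finset.univ \ {i, j}, d k = 0 := Finset.sum_eq_zero_iff.1 hzero
  have hi1 : d i = 1 := by omega
  have hj1 : d j = 1 := by omega
  rw [← Finset.sum_sdiff (Finset.subset_univ {i, j}), Finset.sum_pair hij,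
    Finset.sum_eq_zero fun k hk => by rw [h0 k hk]; simp]
  simp [hi1, hj1]

section Splitting

variable {M : Type*} [EMetricSpace M] [ChartedSpace (EuclideanSpace ℝ (Fin 2)) M]
  [RiemannianBundle (fun x : M => TangentSpace (𝓡 2) x)]

/-- The exponent of a nonzero vector is the rate of one of the nontrivial summands. -/
lemma exists_chiVec_eq {f : Diffeomorph (𝓡 2) (𝓡 2) M M 1} {x : M} {p : ℕ} {lam : Fin p → ℝ}
    {H : Fin p → Submodule ℝ (TangentSpace (𝓡 2) x)} (hlam : StrictAnti lam)
    (hH : DirectSum.IsInternal H)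
    (hrate : ∀ i, ∀ v ∈ H i, v ≠ 0 → UpperRate (fun n : ℕ => ‖D f n x v‖) (lam i) ∧
      LowerRate (fun n : ℕ => ‖D f n x v‖) (lam i))
    {v : TangentSpace (𝓡 2) x} (hv : v ≠ 0) : ∃ i, H i ≠ ⊥ ∧ chiVec f x v = lam i := by
  classical
  obtain ⟨g, hgH, hgv⟩ := (Submodule.mem_iSup_iff_exists_finsupp H v).1
    (hH.submodule_iSup_eq_top ▸ Submodule.mem_top)
  have hsum : ∑ i, g i = v := by rw [← hgv, Finsupp.sum_fintype _ _ fun _ => rfl]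
  have hne : g.support.Nonempty := by
    rw [Finset.nonempty_iff_ne_empty, Ne, Finsupp.support_eq_empty]
    rintro rfl
    exact hv (by rw [← hsum]; simp)
  obtain ⟨i, his, hmax⟩ := g.support.exists_max_image lam hne
  have hi : g i ≠ 0 := Finsupp.mem_support_iff.1 his
  refine ⟨i, fun h => hi (by simpa [h] using hgH i), ?_⟩
  have hup : ∀ j, UpperRate (fun n : ℕ => ‖D f n x (g j)‖) (lam i) := by
    intro j
    by_cases hj : g j = 0
    · simpa [hj] using upperRate_zero (lam i)
    · exact (hrate j _ (hgH j) hj).1.mono (hmax j (Finsupp.mem_support_iff.2 hj))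
  have hlow : ∀ j ∈ Finset.univ.erase i, ∃ m < lam i, UpperRate (fun n : ℕ => ‖D f n x (g j)‖) m := by
    intro j hj
    by_cases hj0 : g j = 0
    · exact ⟨lam i - 1, by linarith, by simpa [hj0] using upperRate_zero (lam i - 1)⟩
    · refine ⟨lam j, lt_of_le_of_ne (hmax j (Finsupp.mem_support_iff.2 hj0)) fun h => ?_,
        (hrate j _ (hgH j) hj0).1⟩
      exact (Finset.ne_of_mem_erase hj) (hlam.injective h)
  have hD : ∀ n : ℕ, D f n x v = ∑ j, D f n x (g j) := fun n => by rw [← hsum, map_sum]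
  refine limsup_log_eq (g' := fun n : ℕ => ‖D f n x v‖) (fun n => (ofReal_norm _).symm) ?_ ?_
  · refine UpperRate.of_le (UpperRate.sum (s := Finset.univ) fun j _ => hup j) zero_le_one
      (Eventually.of_forall fun n => ?_)
    rw [hD, one_mul]
    exact norm_sum_le _ _
  · refine LowerRate.of_le ((hrate i _ (hgH i) hi).2.sub_sum hlow) one_pos
      (Eventually.of_forall fun n => ?_)
    have h1 : D f n x (g i) = D f n x v - ∑ j ∈ Finset.univ.erase i, D f n x (g j) := by
      rw [hD, ← Finset.add_sum_erase _ _ (Finset.mem_univ i), add_sub_cancel_right]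
    have h2 := (congrArg norm h1).le.trans ((norm_sub_le _ _).trans
      (add_le_add le_rfl (norm_sum_le _ _)))
    linarith

/-- At a regular point with `χ₁ > 0 > χ₂` there is a basis of the tangent space whose vectors and
whose area grow at prescribed rates. -/
theorem exists_saddle_basis {f : Diffeomorph (𝓡 2) (𝓡 2) M M 1} {x : M}
    (hx : x ∈ regularSaddle f) :
    ∃ (l₁ l₂ : ℝ) (e₁ e₂ : TangentSpace (𝓡 2) x), l₂ ≤ l₁ ∧ LinearIndependent ℝ ![e₁, e₂] ∧
      UpperRate (fun n : ℕ => ‖D f n x e₁‖) l₁ ∧ UpperRate (fun n : ℕ => ‖D f n x e₂‖) l₂ ∧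
      LowerRate (fun n : ℕ => linJac (D f n x)) (l₁ + l₂) := by
  obtain ⟨⟨p, lam, H, hlam, hrange, hH, hvec, hjac⟩, hpos, hneg⟩ := hx
  have hrate : ∀ i, ∀ v ∈ H i, v ≠ 0 → UpperRate (fun n : ℕ => ‖D f n x v‖) (lam i) ∧
      LowerRate (fun n : ℕ => ‖D f n x v‖) (lam i) := by
    intro i v hv hv0
    refine rates_of_tendsto_int (g := fun n => ‖D f n x v‖) (fun n => ?_)
      ((hvec i atTop (by simp)).1 v hv hv0)
    exact norm_pos_iff.2 fun h => hv0 (D_injective f n x (h.trans (map_zero _).symm))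
  have hexp : ∀ c ∈ exponents f x, ∃ i, H i ≠ ⊥ ∧ c = lam i := by
    rintro c ⟨v, hv, rfl⟩
    exact exists_chiVec_eq hlam hH hrate hv
  obtain ⟨c₁, hc₁, hc₁pos⟩ := lt_sSup_iff.1 hpos
  obtain ⟨c₂, hc₂, hc₂neg⟩ := sInf_lt_iff.1 hneg
  obtain ⟨i, hi, rfl⟩ := hexp c₁ hc₁
  obtain ⟨j, hj, rfl⟩ := hexp c₂ hc₂
  have hi' : 0 < lam i := by exact_mod_cast hc₁pos
  have hj' : lam j < 0 := by exact_mod_cast hc₂neg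
  have hij : i ≠ j := by rintro rfl; linarith
  obtain ⟨e₁, he₁, he₁0⟩ := (Submodule.ne_bot_iff _).1 hi
  obtain ⟨e₂, he₂, he₂0⟩ := (Submodule.ne_bot_iff _).1 hj
  refine ⟨lam i, lam j, e₁, e₂, by linarith,
    linearIndependent_pair_of_disjoint (hH.submodule_iSupIndep.pairwiseDisjoint hij)
      he₁ he₂ he₁0 he₂0, (hrate i e₁ he₁ he₁0).1, (hrate j e₂ he₂ he₂0).1, ?_⟩
  have hd := (sum_finrank_of_isInternal hH).trans (finrank_tangentSpace x)
  have hj := hjac atTop (by simp)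
  rw [sum_mul_eq_of_sum_eq_two hd hij (fun h => hi (Submodule.finrank_eq_zero.1 h))
    (fun h => ‹H j ≠ ⊥› (Submodule.finrank_eq_zero.1 h)) lam] at hj
  exact (rates_of_tendsto_int (g := fun n => linJac (D f n x))
    (fun n => linJac_pos (D_injective f n x)) hj).2

end Splitting

lemma mem_stableSet_self {M : Type*} [EMetricSpace M] [ChartedSpace (EuclideanSpace ℝ (Fin 2)) M]
    (f : Diffeomorph (𝓡 2) (𝓡 2) M M 1) (x : M) : x ∈ stableSet f x := by
  have h : (fun n : ℕ => ENNReal.log (edist (iter f n x) (iter f n x)) / (n : EReal)) =ᶠ[atTop]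
      fun _ => ⊥ := by
    filter_upwards [eventually_gt_atTop 0] with n hn
    rw [edist_self, ENNReal.log_zero, EReal.bot_div_of_pos_ne_top (by exact_mod_cast hn)
      (EReal.natCast_ne_top n)]
  change limsup (fun n : ℕ => ENNReal.log (edist (iter f n x) (iter f n x)) / (n : EReal))
    atTop < 0
  rw [limsup_congr h, limsup_const]
  exact EReal.bot_lt_zero

section StableSet

variable {M : Type*} [EMetricSpace M] [ChartedSpace (EuclideanSpace ℝ (Fin 2)) M]
  [RiemannianBundle (fun x : M => TangentSpace (𝓡 2) x)]

/-- The rate of the norms of the differentials is determined by the rates of tangent vectors. -/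
lemma chi_eq_of_rates {f : Diffeomorph (𝓡 2) (𝓡 2) M M 1} {y : M} {l : ℝ}
    (hup : ∀ v : TangentSpace (𝓡 2) y, UpperRate (fun n : ℕ => ‖D f n y v‖) l)
    (hlow : ∃ v : TangentSpace (𝓡 2) y, LowerRate (fun n : ℕ => ‖D f n y v‖) l) :
    chi f y = l := by
  refine limsup_log_eq (g' := fun n : ℕ => ‖D f n y‖) (fun n => (ofReal_norm _).symm) ?_ ?_
  · set o := stdOrthonormalBasis ℝ (TangentSpace (𝓡 2) y)
    refine UpperRate.of_le (UpperRate.sum (s := Finset.univ) fun i _ => hup (o i)) zero_le_one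
      (Eventually.of_forall fun n => ?_)
    rw [one_mul]
    refine ContinuousLinearMap.opNorm_le_bound _ (Finset.sum_nonneg fun _ _ => norm_nonneg _)
      fun v => ?_
    have h1 : D f n y v = ∑ i, (inner ℝ (o i) v : ℝ) • D f n y (o i) := by
      conv_lhs => rw [← o.sum_repr' v]
      rw [map_sum]
      exact Finset.sum_congr rfl fun i _ => map_smul _ _ _
    refine (congrArg norm h1).le.trans ((norm_sum_le _ _).trans ?_)
    rw [Finset.sum_mul]
    refine Finset.sum_le_sum fun i _ => ?_
    rw [norm_smul, mul_comm]
    gcongr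
    have h2 := norm_inner_le_norm (𝕜 := ℝ) (o i) v
    rwa [o.orthonormal.1 i, one_mul] at h2
  · obtain ⟨v, hv⟩ := hlow
    refine LowerRate.of_le hv (C := ‖v‖ + 1) (by positivity) (Eventually.of_forall fun n => ?_)
    refine (ContinuousLinearMap.le_opNorm _ _).trans ?_
    rw [mul_comm]
    gcongr
    linarith

variable [IsManifold (𝓡 2) 2 M]

lemma planeDiff_surjective {f : Diffeomorph (𝓡 2) (𝓡 2) M M 1} {n : ℕ} {z p : M} {C : ℝ≥0}
    (hz : iter f n p ∈ (extChartAt (𝓡 2) z).source) (hC : HasChartBound C z (iter f n p)) :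
    Function.Surjective (planeDiff (extChartAt (𝓡 2) z ∘ iter f n) p) := by
  have hinj : Function.Injective
      ((planeDiff (extChartAt (𝓡 2) z ∘ iter f n) p : TangentSpace (𝓡 2) p →L[ℝ] Plane) :
        TangentSpace (𝓡 2) p →ₗ[ℝ] Plane) := by
    refine (injective_iff_map_eq_zero _).2 fun v hv => ?_
    have h1 : chartDeriv z (iter f n p) (D f n p v) = 0 := by
      rw [← planeDiff_comp_iter hz]; exact hv
    have h2 := (hC (D f n p v)).2
    rw [h1, norm_zero, mul_zero] at h2
    exact D_injective f n p ((norm_le_zero_iff.1 h2).trans (map_zero _).symm)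
  exact (LinearMap.injective_iff_surjective_of_finrank_eq_finrank
    ((finrank_tangentSpace p).trans (finrank_euclideanSpace_fin (𝕜 := ℝ) (n := 2)).symm)).1 hinj

/-- All points of the stable set of a saddle point have the same maximal exponent. -/
theorem exists_forall_chi_eq [CompactSpace M]
    [IsContinuousRiemannianBundle (EuclideanSpace ℝ (Fin 2)) (fun x : M => TangentSpace (𝓡 2) x)]
    [IsRiemannianManifold (𝓡 2) M] {f : Diffeomorph (𝓡 2) (𝓡 2) M M 1} {α : ℝ≥0} (hα : 0 < α)
    (hα1 : α ≤ 1) (hf : IsC1Holder f α) {x : M} (hx : x ∈ regularSaddle f) :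
    ∃ l : ℝ, ∀ y ∈ stableSet f x, chi f y = l := by
  obtain ⟨l₁, l₂, e₁, e₂, hl, hind, he₁, he₂, hjac⟩ := exists_saddle_basis hx
  obtain ⟨c, C, hcC⟩ := exists_chart_selection hα1 hf
  refine ⟨l₁, fun y hy => ?_⟩
  obtain ⟨δ, hδ, hdist⟩ := exists_edist_le_of_limsup_neg hy
  set z : ℕ → M := fun n => c (iter f n x) with hz
  set G : ℕ → Plane → Plane := fun n => inCharts f (z n) (z (n + 1)) with hG
  have hzsucc : ∀ n : ℕ, c (f (iter f n x)) = z (n + 1) := fun n => by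
    simp only [hz, iter_succ, Function.comp_apply]
  -- charts along the orbit of `x`
  have hsx : ∀ n : ℕ, iter f n x ∈ (extChartAt (𝓡 2) (z n)).source ∧
      HasChartBound C (z n) (iter f n x) := fun n =>
    have h := refl_mem_uniformity (x := iter f n x) hcC
    ⟨h.1, h.2.1⟩
  -- charts along the orbit of `y`
  have hlim : Tendsto (fun n : ℕ => (iter f n x, iter f n y)) atTop (𝓤 M) := by
    rw [uniformity_basis_edist.tendsto_right_iff]
    intro ε hε
    have h1 : Tendsto (fun n : ℕ => ENNReal.ofReal (Real.exp (-δ * n))) atTop (𝓝 0) := by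
      rw [← ENNReal.ofReal_zero]
      refine (ENNReal.continuous_ofReal.tendsto 0).comp (Real.tendsto_exp_atBot.comp ?_)
      exact tendsto_natCast_atTop_atTop.const_mul_atTop_of_neg (by linarith)
    filter_upwards [hdist, h1.eventually_lt_const hε] with n h2 h3
    exact h2.trans_lt h3
  obtain ⟨N₀, hN₀⟩ := eventually_atTop.1 (hlim.eventually hcC)
  set A : ℕ → Plane →L[ℝ] Plane :=
    fun n => fderiv ℝ (G n) (extChartAt (𝓡 2) (z n) (iter f n x)) with hA
  set B : ℕ → Plane →L[ℝ] Plane :=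
    fun n => fderiv ℝ (G n) (extChartAt (𝓡 2) (z n) (iter f n y)) with hB
  set orb : ∀ p : M, TangentSpace (𝓡 2) p → ℕ → Plane :=
    fun p v n => planeDiff (extChartAt (𝓡 2) (z n) ∘ iter f n) p v with horb
  have hnorm : ∀ n (v : TangentSpace (𝓡 2) x), orb x v n =
      chartDeriv (z n) (iter f n x) (D f n x v) := fun n v => planeDiff_comp_iter (hsx n).1 v
  have hnormy : ∀ n ≥ N₀, ∀ v : TangentSpace (𝓡 2) y, orb y v n =
      chartDeriv (z n) (iter f n y) (D f n y v) := fun n hn v =>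
    planeDiff_comp_iter (hN₀ n hn).1 v
  have horby : ∀ v : TangentSpace (𝓡 2) y, ∀ n ≥ N₀, orb y v (n + 1) = B n (orb y v n) :=
    fun v n hn => planeDiff_succ (hN₀ n hn).1 (hN₀ (n + 1) (by omega)).1 v
  obtain ⟨K, hK, hKle⟩ := exists_linJac_le (finrank_tangentSpace x) hind
  have H : PerturbedRegular A B (orb x e₁) (orb x e₂) l₁ l₂ := by
    refine ⟨hl, fun n => planeDiff_succ (hsx n).1 (hsx (n + 1)).1 e₁,
      fun n => planeDiff_succ (hsx n).1 (hsx (n + 1)).1 e₂, ?_, ?_, ?_, ?_⟩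
    · refine ⟨C, C.coe_nonneg, δ * α, by positivity, ?_⟩
      filter_upwards [hdist, eventually_ge_atTop N₀] with n h1 hn
      have h2 := (hN₀ n hn).2.2
      simp only [hzsucc] at h2
      have h3 : edist (A n) (B n) ≤ ENNReal.ofReal (C * Real.exp (-(δ * α) * n)) := by
        refine h2.trans ?_
        rw [ENNReal.ofReal_mul C.coe_nonneg, ENNReal.ofReal_coe_nnreal]
        gcongr
        refine (ENNReal.rpow_le_rpow h1 α.coe_nonneg).trans (le_of_eq ?_)
        rw [ENNReal.ofReal_rpow_of_pos (Real.exp_pos _), ← Real.exp_mul]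
        congr 2
        ring
      rw [edist_dist, ENNReal.ofReal_le_ofReal_iff (by positivity)] at h3
      rwa [← dist_eq_norm, dist_comm]
    · exact he₁.of_le C.coe_nonneg (Eventually.of_forall fun n => by
        rw [hnorm]; exact ((hsx n).2 _).1)
    · exact he₂.of_le C.coe_nonneg (Eventually.of_forall fun n => by
        rw [hnorm]; exact ((hsx n).2 _).1)
    · refine LowerRate.of_le hjac (C := K * C ^ 2 + 1) (by positivity)
        (Eventually.of_forall fun n => ?_)
      refine (hKle (D f n x) C (chartDeriv (z n) (iter f n x)).toLinearMap
        (fun w => ((hsx n).2 w).2)).trans ?_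
      rw [hnorm, hnorm]
      refine mul_le_mul_of_nonneg_right ?_ (abs_nonneg _)
      linarith
  refine chi_eq_of_rates (fun v => ?_) ?_
  · have h1 : UpperRate (fun n => ‖orb y v n‖) l₁ := fun ε hε => H.norm_le (horby v) hε
    refine h1.of_le C.coe_nonneg ?_
    filter_upwards [eventually_ge_atTop N₀] with n hn
    rw [hnormy n hn]
    exact ((hN₀ n hn).2.1 _).2
  · obtain ⟨N, hN, hV⟩ := H.exists_le_norm N₀
    obtain ⟨v, hv⟩ := planeDiff_surjective (hN₀ N hN).1 (hN₀ N hN).2.1 (orb x e₁ N)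
    have h1 : LowerRate (fun n => ‖orb y v n‖) l₁ :=
      hV (orb y v) hv (fun n hn => horby v n (hN.trans hn))
    refine ⟨v, h1.of_le (C := C + 1) (by positivity) ?_⟩
    filter_upwards [eventually_ge_atTop N₀] with n hn
    rw [hnormy n hn]
    refine ((hN₀ n hn).2.1 _).1.trans ?_
    gcongr
    linarith

end StableSet

end SurfaceDiffeo

end

theorem mainTheorem8 {M : Type*} [EMetricSpace M] [CompactSpace M]
    [ChartedSpace (EuclideanSpace ℝ (Fin 2)) M] [IsManifold (𝓡 2) 2 M]
    [RiemannianBundle (fun x : M => TangentSpace (𝓡 2) x)]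
    [IsContinuousRiemannianBundle (EuclideanSpace ℝ (Fin 2))
      (fun x : M => TangentSpace (𝓡 2) x)]
    [IsRiemannianManifold (𝓡 2) M]
    (f : Diffeomorph (𝓡 2) (𝓡 2) M M 1)
    (α : ℝ≥0) (hα : 0 < α) (hα1 : α ≤ 1) (hf : SurfaceDiffeo.IsC1Holder f α)
    (x : M) (hx : x ∈ SurfaceDiffeo.regularSaddle f)
    (y : M) (hy : y ∈ SurfaceDiffeo.stableSet f x) :
    SurfaceDiffeo.chi f y = SurfaceDiffeo.chi f x := by
  obtain ⟨l, hl⟩ := SurfaceDiffeo.exists_forall_chi_eq hα hα1 hf hx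
  rw [hl y hy, hl x (SurfaceDiffeo.mem_stableSet_self f x)]
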